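/- Let $B$ be a definite quaternion algebra over $\mathbb{Q}$ of discriminant $N$ (the product of the finite primes ramified in $B$), let $\mathcal{O}$ be a maximal order in $B$, let $\mathrm{Cl}(\mathcal{O})$ be the set of (invertible) right $\mathcal{O}$-ideal classes, and let $M(\mathcal{O})$ be the space of functions $\phi:\mathrm{Cl}(\mathcal{O})\to\mathbb{C}$. For a prime $p\mid N$ let $\sigma_p$ be the involution $[\mathcal{I}]\mapsto[\mathcal{I}\mathfrak{P}_p]$ of $\mathrm{Cl}(\mathcal{O})$, where $\mathfrak{P}_p$ is the two-sided prime ideal of $\mathcal{O}$ of reduced norm $p$, and put $\sigma_N=\prod_{p\mid N}\sigma_p$. A sign pattern $\varepsilon$ for $N$ is a multiplicative function $d\mapsto\varepsilon_d\in\{\pm1\}$ on the divisors of $N$; put $$M^\varepsilon(\mathcal{O})=\{\phi\in M(\mathcal{O}) : \phi(\sigma_p(x))=\varepsilon_p\,\phi(x)\text{ for all primes }p\mid N\text{ and all }x\in\mathrm{Cl}(\mathcal{O})\}.$$ An eigenform is a nonzero $\phi\in M(\mathcal{O})$ that is an eigenvector of the Hecke operator $T_p$ for every prime $p\nmid N$,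 where $(T_p\phi)([\mathcal{I}])=\sum_{\mathcal{J}}\phi([\mathcal{J}])$, the sum being over the right $\mathcal{O}$-ideals $\mathcal{J}\subseteq\mathcal{I}$ of index $p^2$. Let $\Sigma^\varepsilon$ be the signed multigraph on $\mathrm{Cl}(\mathcal{O})$ that has, for each prime $p\mid N$ and each orbit $\{x,\sigma_p(x)\}$ of $\sigma_p$, an edge of sign $\varepsilon_p$ between $x$ and $\sigma_p(x)$ (a loop if $\sigma_p(x)=x$). The parity of a path is the product of the signs of its edges. For $\phi\in M^\varepsilon(\mathcal{O})$, a zero $x$ of $\phi$ is called a trivial zero if the connected component of $x$ in $\Sigma^\varepsilon$ contains a closed path of parity $-1$ (vertices and edges may be repeated). Then $\sigma_N$ has a fixed point on $\mathrm{Cl}(\mathcal{O})$, and for every sign pattern $\varepsilon$ for $N$ with $\varepsilon_N=-1$, every eigenform in $M^\varepsilon(\mathcal{O})$ has a trivial zero. -/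

import Mathlib

open scoped Quaternion

noncomputable section

namespace DefiniteQuaternion

/-- The quaternion algebra `(a, b / ℚ)`, with `i² = a`, `j² = b`, `ij = -ji`. Every definite
quaternion algebra over `ℚ` is, up to isomorphism, of this form with `a < 0` and `b < 0`. -/
abbrev QAlg (a b : ℚ) : Type := ℍ[ℚ, a, b]

variable {a b : ℚ}

/-- The reduced norm of `B = (a, b / ℚ)`; here `star` is the canonical involution. -/
def nrd (x : QAlg a b) : ℚ := (x * star x).re

/-- The prime `p` is ramified in `B = (a, b / ℚ)`: the completion
`B ⊗ ℚ_p = (a, b / ℚ_p)` is a division algebra. -/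
def IsRamified (a b : ℚ) (p : Nat.Primes) : Prop :=
  haveI : Fact (p : ℕ).Prime := ⟨p.2⟩
  ∀ x : ℍ[ℚ_[(p : ℕ)], (a : ℚ_[(p : ℕ)]), (b : ℚ_[(p : ℕ)])], x ≠ 0 → IsUnit x

/-- `N` is the discriminant of `B = (a, b / ℚ)`, i.e. the product of the (distinct) finite primes
that are ramified in `B`. -/
def IsDiscriminant (a b : ℚ) (N : ℕ) : Prop :=
  Squarefree N ∧ ∀ p : Nat.Primes, (p : ℕ) ∣ N ↔ IsRamified a b p

/-- A full `ℤ`-lattice in `B`. -/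
def IsFullLattice (L : Submodule ℤ (QAlg a b)) : Prop :=
  L.FG ∧ Submodule.span ℚ (L : Set (QAlg a b)) = ⊤

/-- An order of `B`: a subring that is a full `ℤ`-lattice. -/
def IsOrder (O : Subalgebra ℤ (QAlg a b)) : Prop :=
  IsFullLattice (Subalgebra.toSubmodule O)

/-- A maximal order of `B`. -/
def IsMaximalOrder (O : Subalgebra ℤ (QAlg a b)) : Prop :=
  IsOrder O ∧ ∀ O' : Subalgebra ℤ (QAlg a b), IsOrder O' → O ≤ O' → O' = O

/-- A (fractional) right `O`-ideal: a full lattice `I` with `I O ⊆ I`. When `O` is a maximal order,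
every such lattice has right order `O` and is invertible, so these are exactly the invertible
right `O`-ideals. -/
@[ext]
structure RightIdeal (O : Subalgebra ℤ (QAlg a b)) where
  /-- the underlying lattice -/
  lattice : Submodule ℤ (QAlg a b)
  full : IsFullLattice lattice
  mul_mem : ∀ x ∈ lattice, ∀ y ∈ O, x * y ∈ lattice

variable {O : Subalgebra ℤ (QAlg a b)}

lemma isFullLattice_map_mulLeft (u : (QAlg a b)ˣ) {L : Submodule ℤ (QAlg a b)}
    (hL : IsFullLattice L) :
    IsFullLattice (L.map (LinearMap.mulLeft ℤ (u : QAlg a b))) := by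
  refine ⟨hL.1.map _, ?_⟩
  have h : ((L.map (LinearMap.mulLeft ℤ (u : QAlg a b)) : Submodule ℤ (QAlg a b)) :
      Set (QAlg a b)) = LinearMap.mulLeft ℚ (u : QAlg a b) '' (L : Set (QAlg a b)) := by
    ext x; simp
  rw [h, Submodule.span_image, hL.2, Submodule.map_top, LinearMap.range_eq_top]
  intro x
  exact ⟨(↑u⁻¹ : QAlg a b) * x, by simp⟩

/-- The right ideal `u I`, for `u ∈ Bˣ`. -/
def RightIdeal.translate (u : (QAlg a b)ˣ) (I : RightIdeal O) : RightIdeal O where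
  lattice := I.lattice.map (LinearMap.mulLeft ℤ (u : QAlg a b))
  full := isFullLattice_map_mulLeft u I.full
  mul_mem := by
    rintro _ ⟨x, hx, rfl⟩ y hy
    exact ⟨x * y, I.mul_mem x hx y hy, by simp [mul_assoc]⟩

lemma RightIdeal.mem_translate {u : (QAlg a b)ˣ} {I : RightIdeal O} {x : QAlg a b} :
    x ∈ (I.translate u).lattice ↔ (↑u⁻¹ : QAlg a b) * x ∈ I.lattice := by
  constructor
  · rintro ⟨y, hy, rfl⟩
    simpa using hy
  · intro h
    exact ⟨_, h, by simp⟩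

lemma RightIdeal.translate_one (I : RightIdeal O) : I.translate 1 = I := by
  ext x; simp [RightIdeal.mem_translate]

lemma RightIdeal.translate_translate (u v : (QAlg a b)ˣ) (I : RightIdeal O) :
    (I.translate v).translate u = I.translate (u * v) := by
  ext x; simp [RightIdeal.mem_translate, mul_assoc]

/-- Two right ideals `I`, `J` are in the same class when `J = u I` for some `u ∈ Bˣ`. -/
instance RightIdeal.setoid (O : Subalgebra ℤ (QAlg a b)) : Setoid (RightIdeal O) where
  r I J := ∃ u : (QAlg a b)ˣ, J = I.translate u
  iseqv :=
    { refl := fun I => ⟨1, I.translate_one.symm⟩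
      symm := by
        rintro I _ ⟨u, rfl⟩
        exact ⟨u⁻¹, by rw [translate_translate, inv_mul_cancel, translate_one]⟩
      trans := by
        rintro I _ _ ⟨u, rfl⟩ ⟨v, rfl⟩
        exact ⟨v * u, by rw [translate_translate]⟩ }

/-- The set `Cl(O)` of right `O`-ideal classes. -/
def Cl (O : Subalgebra ℤ (QAlg a b)) : Type := Quotient (RightIdeal.setoid O)

/-- The class of a right ideal. -/
def RightIdeal.cls (I : RightIdeal O) : Cl O := Quotient.mk (RightIdeal.setoid O) I

/-- The two-sided `O`-ideal generated by the elements of `O` with reduced norm divisible by `p`.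
When `O` is maximal and `p` is ramified in `B`, the elements of `O` with reduced norm divisible
by `p` already form a two-sided ideal, so this is `{x ∈ O : p ∣ nrd x}`: the unique two-sided prime
ideal of `O` above `p`, of reduced norm `p`, which at `p` is generated by a uniformizer of `O_p`
and which equals `O` at the other primes. -/
def primeIdeal (O : Subalgebra ℤ (QAlg a b)) (p : Nat.Primes) : Submodule ℤ (QAlg a b) :=
  Subalgebra.toSubmodule O *
    Submodule.span ℤ {x : QAlg a b | x ∈ O ∧ ∃ k : ℤ, nrd x = (p : ℕ) * k} *
    Subalgebra.toSubmodule O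

lemma primeIdeal_le (O : Subalgebra ℤ (QAlg a b)) (p : Nat.Primes) :
    primeIdeal O p ≤ Subalgebra.toSubmodule O := by
  have h1 : Submodule.span ℤ {x : QAlg a b | x ∈ O ∧ ∃ k : ℤ, nrd x = (p : ℕ) * k} ≤
      Subalgebra.toSubmodule O := Submodule.span_le.2 fun x hx => hx.1
  refine (mul_le_mul' (mul_le_mul' le_rfl h1) le_rfl).trans ?_
  rw [O.isIdempotentElem_toSubmodule.eq, O.isIdempotentElem_toSubmodule.eq]

lemma natCast_mem_primeIdeal (O : Subalgebra ℤ (QAlg a b)) (p : Nat.Primes) :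
    ((p : ℕ) : QAlg a b) ∈ primeIdeal O p := by
  have h : ((p : ℕ) : QAlg a b) ∈
      Submodule.span ℤ {x : QAlg a b | x ∈ O ∧ ∃ k : ℤ, nrd x = (p : ℕ) * k} := by
    refine Submodule.subset_span ⟨natCast_mem O _, (p : ℕ), ?_⟩
    simp [nrd]
  have h1 : (1 : QAlg a b) ∈ Subalgebra.toSubmodule O := O.one_mem
  simpa [primeIdeal] using Submodule.mul_mem_mul (Submodule.mul_mem_mul h1 h) h1

lemma primeIdeal_mul_mem (O : Subalgebra ℤ (QAlg a b)) (p : Nat.Primes) :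
    primeIdeal O p * Subalgebra.toSubmodule O = primeIdeal O p := by
  rw [primeIdeal, mul_assoc, O.isIdempotentElem_toSubmodule.eq]

/-- The right ideal `I 𝔓_p`. -/
def RightIdeal.mulPrime (hO : IsOrder O) (p : Nat.Primes) (I : RightIdeal O) : RightIdeal O where
  lattice := I.lattice * primeIdeal O p
  full := by
    refine ⟨I.full.1.mul ?_, ?_⟩
    · exact Submodule.FG.of_le hO.1 (primeIdeal_le O p)
    · rw [eq_top_iff, ← I.full.2, Submodule.span_le]
      intro x hx
      have hp : ((p : ℕ) : ℚ) ≠ 0 := by exact_mod_cast p.2.ne_zero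
      have h1 : x * ((p : ℕ) : QAlg a b) ∈ I.lattice * primeIdeal O p :=
        Submodule.mul_mem_mul hx (natCast_mem_primeIdeal O p)
      have h2 : x = (((p : ℕ) : ℚ)⁻¹) • (x * ((p : ℕ) : QAlg a b)) := by
        rw [← nsmul_eq_mul', ← Nat.cast_smul_eq_nsmul ℚ, smul_smul, inv_mul_cancel₀ hp, one_smul]
      rw [h2]
      exact Submodule.smul_mem _ _ (Submodule.subset_span h1)
  mul_mem := by
    intro x hx y hy
    have h : x * y ∈ I.lattice * primeIdeal O p * Subalgebra.toSubmodule O :=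
      Submodule.mul_mem_mul hx hy
    rwa [mul_assoc, primeIdeal_mul_mem] at h

lemma RightIdeal.mulPrime_translate (hO : IsOrder O) (p : Nat.Primes) (u : (QAlg a b)ˣ)
    (I : RightIdeal O) : (I.translate u).mulPrime hO p = (I.mulPrime hO p).translate u := by
  have h (L : Submodule ℤ (QAlg a b)) :
      L.map (LinearMap.mulLeft ℤ (u : QAlg a b)) = Submodule.span ℤ {(u : QAlg a b)} * L := by
    ext x; simp [Submodule.mem_span_singleton_mul]
  apply RightIdeal.ext
  simp only [mulPrime, translate, h, mul_assoc]

/-- The local involution `σ_p : [I] ↦ [I 𝔓_p]` of `Cl(O)` (for `p` dividing the discriminant). -/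
def sigma (hO : IsOrder O) (p : Nat.Primes) : Cl O → Cl O :=
  Quotient.map (RightIdeal.mulPrime hO p) (by
    rintro I _ ⟨u, rfl⟩
    exact ⟨u, RightIdeal.mulPrime_translate hO p u I⟩)

/-- `σ_N = ∏_{p ∣ N} σ_p`, the composition of the involutions `σ_p` over the prime factors of `N`
(counted with multiplicity, in increasing order; the `σ_p` commute). -/
def sigmaProd (hO : IsOrder O) (N : ℕ) : Cl O → Cl O :=
  (N.primeFactorsList.pmap (fun p hp => sigma hO ⟨p, hp⟩)
    fun _ hp => Nat.prime_of_mem_primeFactorsList hp).foldr (· ∘ ·) id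

/-- The space `M(O)` of quaternionic modular forms of level `O` with trivial weight. -/
abbrev QMF (O : Subalgebra ℤ (QAlg a b)) : Type := Cl O → ℂ

/-- The right `O`-ideals `J ⊆ I` of relative reduced norm `n`, i.e. of index `n²`. -/
def RightIdeal.subIdeals (I : RightIdeal O) (n : ℕ) : Set (RightIdeal O) :=
  {J | J.lattice ≤ I.lattice ∧
    J.lattice.toAddSubgroup.relIndex I.lattice.toAddSubgroup = n ^ 2}

lemma RightIdeal.translate_mem_subIdeals {u : (QAlg a b)ˣ} {I J : RightIdeal O} {n : ℕ}
    (h : J ∈ I.subIdeals n) : J.translate u ∈ (I.translate u).subIdeals n := by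
  refine ⟨Submodule.map_mono h.1, ?_⟩
  rw [← h.2]
  have hinj : Function.Injective (LinearMap.mulLeft ℤ (u : QAlg a b)).toAddMonoidHom := by
    intro x y hxy
    exact u.isUnit.mul_left_cancel hxy
  exact AddSubgroup.relIndex_map_map_of_injective J.lattice.toAddSubgroup
    I.lattice.toAddSubgroup hinj

/-- The Hecke operator `T_n` on `M(O)`: `(T_n φ)([I]) = ∑_J φ([J])`, the sum over the (finitely
many) right `O`-ideals `J ⊆ I` of relative reduced norm `n`. -/
def hecke (O : Subalgebra ℤ (QAlg a b)) (n : ℕ) (φ : QMF O) : QMF O :=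
  Quotient.lift (fun I : RightIdeal O => ∑ᶠ J ∈ I.subIdeals n, φ J.cls) (by
    rintro I _ ⟨u, rfl⟩
    refine finsum_mem_eq_of_bijOn (RightIdeal.translate u) ⟨?_, ?_, ?_⟩ ?_
    · exact fun J hJ => RightIdeal.translate_mem_subIdeals hJ
    · intro J _ J' _ h
      have h2 := congrArg (RightIdeal.translate u⁻¹) h
      simpa [RightIdeal.translate_translate, RightIdeal.translate_one] using h2
    · intro J hJ
      refine ⟨J.translate u⁻¹, ?_, ?_⟩
      · have h := RightIdeal.translate_mem_subIdeals (u := u⁻¹) hJ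
        rwa [RightIdeal.translate_translate, inv_mul_cancel, RightIdeal.translate_one] at h
      · rw [RightIdeal.translate_translate, mul_inv_cancel, RightIdeal.translate_one]
    · intro J _
      exact congrArg φ (Quotient.sound ⟨u, rfl⟩))

/-- An eigenform of `M(O)`, for `O` of level `N`: a nonzero simultaneous eigenvector of all `T_p`
with `p` prime, `p ∤ N`. -/
def IsEigenform (N : ℕ) (φ : QMF O) : Prop :=
  φ ≠ 0 ∧ ∀ p : Nat.Primes, ¬ (p : ℕ) ∣ N → ∃ c : ℂ, hecke O p φ = c • φ

/-- A sign pattern for `N`: a multiplicative function `d ↦ ε_d` from the divisors of `N` to `{±1}`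
(the values at non-divisors of `N` are irrelevant). -/
structure SignPattern (N : ℕ) where
  /-- the signs -/
  sign : ℕ → ℤˣ
  map_one : sign 1 = 1
  map_mul : ∀ d e : ℕ, d * e ∣ N → d.Coprime e → sign (d * e) = sign d * sign e

variable {N : ℕ}

/-- The space `M^ε(O)` of the `φ ∈ M(O)` with `φ(σ_p(x)) = ε_p φ(x)` for all primes `p ∣ N`. -/
def signSpace (hO : IsOrder O) (ε : SignPattern N) : Submodule ℂ (QMF O) where
  carrier := {φ | ∀ p : Nat.Primes, (p : ℕ) ∣ N → ∀ x : Cl O,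
    φ (sigma hO p x) = ((ε.sign p : ℤ) : ℂ) * φ x}
  zero_mem' := by intro p _ x; simp
  add_mem' := by
    intro φ ψ hφ hψ p hp x
    simp [hφ p hp x, hψ p hp x, mul_add]
  smul_mem' := by
    intro c φ hφ p hp x
    simp [hφ p hp x, mul_left_comm]

/-- `SignedEdge hO ε x y s`: in the signed multigraph `Σ^ε` on `Cl(O)` there is an (undirected)
edge of sign `s` between `x` and `y`, namely `s = ε_p` and `{x, y} = {x, σ_p(x)}` for some `p ∣ N`;
fixed points of `σ_p` carry loops. -/
def SignedEdge (hO : IsOrder O) (ε : SignPattern N) (x y : Cl O) (s : ℤˣ) : Prop :=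
  ∃ p : Nat.Primes, (p : ℕ) ∣ N ∧ s = ε.sign p ∧ (y = sigma hO p x ∨ x = sigma hO p y)

/-- `SignedPath hO ε x y s`: there is a path in `Σ^ε` from `x` to `y`, possibly with repeated
vertices and edges, whose parity (the product of the signs of its edges) is `s`. -/
inductive SignedPath (hO : IsOrder O) (ε : SignPattern N) : Cl O → Cl O → ℤˣ → Prop
  | nil (x : Cl O) : SignedPath hO ε x x 1
  | cons {x y z : Cl O} {s t : ℤˣ} (h : SignedEdge hO ε x y s) (q : SignedPath hO ε y z t) :
      SignedPath hO ε x z (s * t)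

/-- The connected component of `x` in `Σ^ε`, i.e. the orbit of `x` under the group generated
by the `σ_p`, `p ∣ N`. -/
def component (hO : IsOrder O) (ε : SignPattern N) (x : Cl O) : Set (Cl O) :=
  {y | ∃ s, SignedPath hO ε x y s}

/-- A component `X` is `ε`-admissible if no cycle (closed path) occurring in `X` has
parity `-1`. -/
def IsAdmissible (hO : IsOrder O) (ε : SignPattern N) (X : Set (Cl O)) : Prop :=
  ¬ ∃ y ∈ X, SignedPath hO ε y y (-1)

/-- `x` is a trivial zero of `φ` (with respect to `ε`): `φ ∈ M^ε(O)` vanishes at `x` and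
the orbit of `x` is not `ε`-admissible. -/
def IsTrivialZero (hO : IsOrder O) (ε : SignPattern N) (φ : QMF O) (x : Cl O) : Prop :=
  φ ∈ signSpace hO ε ∧ φ x = 0 ∧ ¬ IsAdmissible hO ε (component hO ε x)

end DefiniteQuaternion

end

open DefiniteQuaternion

open DefiniteQuaternion
open scoped Quaternion

/-! A definite `B` of discriminant `N` contains some `w` with `w² = -N`, and `w` produces a class
fixed by `σ_N`. Put `I = O + wO`. Then `N I ⊆ wI ⊆ I`, so `wI` and `I` agree at every prime not
dividing `N`, and so do `I ∏ 𝔓_p` and `I`. At `p ∣ N` the algebra is a division algebra, right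
ideals are balls for the absolute value of the reduced norm, and passing from `I` to `wI` or to `I ∏
𝔓_p` divides the radius by `p`. Hence `I ∏ 𝔓_p = wI`, which lies in the class of `I`
(`exists_sigmaProd_eq`). If `σ_N x = x` and `ε_N = -1`, then `φ(x) = ε_N φ(x) = -φ(x)`, so `φ(x) =
0`; the path that uses one edge for each `p ∣ N` is closed at `x` and has parity `ε_N = -1`, so the
zero is trivial.

The existence of `w` means that the norm form on trace zero quaternions represents `N`
(`HasSqrtNegDisc.of_neg`). For `B = (-A, -B')` the form is `A x² + B' y² + A B' z²`. Dirichlet's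
theorem gives a prime `q` such that, over `ℚ`, `q` is a value of `A x² + B' y²` and `N A B'` is a
value of `z² + q x²`; together these represent `N`. Both facts are isotropy of ternary forms, hence
follow from Legendre's theorem `Split.of_forall_odd_prime`, where the prime `2` can be ignored.
Quadratic reciprocity ensures that the conditions imposed on `q` are compatible: it encodes that the
number of finite ramified primes is odd.

The local theory is carried out inside `B`, without completing it. At a ramified prime Hensel's
lemma bounds the trace by the norm, so `pnorm` is ultrametric, and a maximal order is locally its
unit ball (`IsMaximalOrder.exists_zsmul_mem`). -/

/-- The ternary quadratic form `a x² + b y² - z²` is isotropic over `K`, i.e. the quaternion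
algebra `(a, b / K)` is split. -/
def Split {K : Type*} [Field K] (a b : K) : Prop :=
  ∃ x y z : K, (x ≠ 0 ∨ y ≠ 0 ∨ z ≠ 0) ∧ a * x ^ 2 + b * y ^ 2 = z ^ 2

/-! ### Isotropy of `a x² + b y² - z²` and norms -/

namespace Split

section Field

variable {K : Type*} [Field K] {a b c s t : K}

lemma symm (h : Split a b) : Split b a := by
  obtain ⟨x, y, z, h0, h⟩ := h
  exact ⟨y, x, z, by tauto, by rw [← h]; ring⟩

lemma comm : Split a b ↔ Split b a := ⟨symm, symm⟩

lemma of_isSquare_left (h : IsSquare a) : Split a b := by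
  obtain ⟨r, rfl⟩ := h
  exact ⟨1, 0, r, by simp, by ring⟩

lemma of_isSquare_right (h : IsSquare b) : Split a b := (of_isSquare_left h).symm

/-- Only the class of `b` modulo norms from `K(√a)` matters: multiply `z + x√a` by `s + t√a`. -/
lemma mul_norm (h : Split a b) (hn : s ^ 2 - a * t ^ 2 ≠ 0) :
    Split a (b * (s ^ 2 - a * t ^ 2)) := by
  obtain ⟨x, y, z, h0, h⟩ := h
  refine ⟨s * x + z * t, y, z * s + a * x * t, ?_, by linear_combination (s ^ 2 - a * t ^ 2) * h⟩
  by_contra! hc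
  obtain ⟨h1, h2, h3⟩ := hc
  have hx : x = 0 := by
    have : (s ^ 2 - a * t ^ 2) * x = 0 := by linear_combination s * h1 - t * h3
    exact (mul_eq_zero.1 this).resolve_left hn
  have hz : z = 0 := by
    have : (s ^ 2 - a * t ^ 2) * z = 0 := by linear_combination s * h3 - a * t * h1
    exact (mul_eq_zero.1 this).resolve_left hn
  tauto

lemma mul_sq_iff (hc : c ≠ 0) : Split a (b * c ^ 2) ↔ Split a b := by
  constructor
  · rintro ⟨x, y, z, h0, h⟩
    refine ⟨x, c * y, z, ?_, by rw [← h]; ring⟩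
    rcases h0 with h0 | h0 | h0
    · exact Or.inl h0
    · exact Or.inr (Or.inl (mul_ne_zero hc h0))
    · exact Or.inr (Or.inr h0)
  · intro h
    simpa using h.mul_norm (s := c) (t := 0) (by simpa using hc)

lemma mul_norm_iff (hn : s ^ 2 - a * t ^ 2 ≠ 0) :
    Split a (b * (s ^ 2 - a * t ^ 2)) ↔ Split a b := by
  refine ⟨fun h => ?_, fun h => h.mul_norm hn⟩
  have := h.mul_norm hn
  rwa [mul_assoc, ← sq, mul_sq_iff hn] at this

/-- `-a` is the norm of `√a`. -/
lemma neg_mul_iff (ha : a ≠ 0) : Split a (-(a * b)) ↔ Split a b := by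
  have := mul_norm_iff (a := a) (b := b) (s := 0) (t := 1) (by simpa using ha)
  rw [← this]
  ring_nf

end Field

section Padic

variable {p : ℕ} [hp : Fact p.Prime]

/-- An isotropic vector over `ℚ_p` can be chosen primitive. -/
lemma exists_primitive {a b : ℤ} (h : Split (a : ℚ_[p]) b) :
    ∃ x y z : ℤ_[p], (x = 1 ∨ y = 1 ∨ z = 1) ∧ a * x ^ 2 + b * y ^ 2 = z ^ 2 := by
  obtain ⟨x, y, z, h0, h⟩ := h
  -- Dividing by a coordinate `w` of largest absolute value makes all coordinates integral and that
  -- one equal to `1`.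
  have key : ∀ w : ℚ_[p], w ≠ 0 → ‖x‖ ≤ ‖w‖ → ‖y‖ ≤ ‖w‖ → ‖z‖ ≤ ‖w‖ → (x = w ∨ y = w ∨ z = w) →
      ∃ x y z : ℤ_[p], (x = 1 ∨ y = 1 ∨ z = 1) ∧ a * x ^ 2 + b * y ^ 2 = z ^ 2 := by
    intro w hw hx hy hz hor
    have hw' : 0 < ‖w‖ := norm_pos_iff.2 hw
    have hint : ∀ v : ℚ_[p], ‖v‖ ≤ ‖w‖ → ∃ v' : ℤ_[p], (v' : ℚ_[p]) = v / w := fun v hv =>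
      ⟨⟨v / w, by rw [norm_div]; exact div_le_one_of_le₀ hv hw'.le⟩, rfl⟩
    obtain ⟨x', hx'⟩ := hint x hx
    obtain ⟨y', hy'⟩ := hint y hy
    obtain ⟨z', hz'⟩ := hint z hz
    refine ⟨x', y', z', ?_, ?_⟩
    · rcases hor with rfl | rfl | rfl
      · left; exact PadicInt.ext (by simp [hw, hx'])
      · right; left; exact PadicInt.ext (by simp [hw, hy'])
      · right; right; exact PadicInt.ext (by simp [hw, hz'])
    · apply PadicInt.ext
      push_cast
      rw [hx', hy', hz']
      field_simp
      exact h
  rcases le_total ‖x‖ ‖y‖ with h1 | h1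
  · rcases le_total ‖y‖ ‖z‖ with h2 | h2
    · refine key z ?_ (h1.trans h2) h2 le_rfl (by simp)
      rintro rfl
      simp_all
    · refine key y ?_ h1 le_rfl h2 (by simp)
      rintro rfl
      simp_all
  · rcases le_total ‖x‖ ‖z‖ with h2 | h2
    · refine key z ?_ h2 (h1.trans h2) le_rfl (by simp)
      rintro rfl
      simp_all
    · refine key x ?_ le_rfl h1 h2 (by simp)
      rintro rfl
      simp_all

end Padic

end Split

/-! ### Local isotropy at odd primes -/

section Padic

variable {p : ℕ} [hp : Fact p.Prime]

lemma isSquare_padic_of_isSquare_zmod (hp2 : p ≠ 2) {a : ℤ} (ha : ¬ (p : ℤ) ∣ a)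
    (h : IsSquare (a : ZMod p)) : IsSquare (a : ℚ_[p]) := by
  obtain ⟨r, hr⟩ := h
  obtain ⟨r, rfl⟩ := ZMod.intCast_surjective r
  have hd : (p : ℤ) ∣ r ^ 2 - a := by
    rw [← ZMod.intCast_zmod_eq_zero_iff_dvd]
    push_cast
    rw [hr]; ring
  have hpr : ¬ (p : ℤ) ∣ r := fun h => ha (by
    have := dvd_sub (h.pow two_ne_zero) hd
    simpa using this)
  have h2 : ¬ (p : ℤ) ∣ 2 * r := by
    intro h
    rcases (Nat.prime_iff_prime_int.1 hp.out).dvd_or_dvd h with h | h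
    · exact hp2 ((Nat.prime_dvd_prime_iff_eq hp.out Nat.prime_two).1 (by exact_mod_cast h))
    · exact hpr h
  have hn1 : ‖((2 * r : ℤ) : ℤ_[p])‖ = 1 := by
    refine le_antisymm (PadicInt.norm_le_one _) (not_lt.1 fun h => h2 ?_)
    exact (PadicInt.norm_int_lt_one_iff_dvd _).1 h
  have hn2 : ‖((r ^ 2 - a : ℤ) : ℤ_[p])‖ < 1 := (PadicInt.norm_int_lt_one_iff_dvd _).2 hd
  let F : Polynomial ℤ_[p] := Polynomial.X ^ 2 - Polynomial.C (a : ℤ_[p])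
  have hF : ‖F.aeval (r : ℤ_[p])‖ < ‖F.derivative.aeval (r : ℤ_[p])‖ ^ 2 := by
    have e1 : F.aeval (r : ℤ_[p]) = ((r ^ 2 - a : ℤ) : ℤ_[p]) := by simp [F]
    have e2 : F.derivative.aeval (r : ℤ_[p]) = ((2 * r : ℤ) : ℤ_[p]) := by
      simp [F, one_add_one_eq_two]
    rw [e1, e2, hn1]
    simpa using hn2
  obtain ⟨z, hz, -⟩ := hensels_lemma hF
  refine ⟨z, ?_⟩
  have : z ^ 2 - (a : ℤ_[p]) = 0 := by simpa [F] using hz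
  have h3 := congrArg (fun x : ℤ_[p] => (x : ℚ_[p])) this
  push_cast at h3
  linear_combination -h3

lemma exists_sq_add_mul_sq_eq_one {a b : ZMod p} (hp2 : p ≠ 2) (ha : a ≠ 0) (hb : b ≠ 0) :
    ∃ x y : ZMod p, a * x ^ 2 + b * y ^ 2 = 1 := by
  have hodd : Fintype.card (ZMod p) % 2 = 1 := by
    rw [ZMod.card]; exact hp.out.eq_two_or_odd.resolve_left hp2
  obtain ⟨x, y, h⟩ := FiniteField.exists_root_sum_quadratic
    (f := Polynomial.C a * Polynomial.X ^ 2) (g := Polynomial.C b * Polynomial.X ^ 2 - Polynomial.C 1)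
    (by compute_degree!) (by compute_degree!) hodd
  refine ⟨x, y, ?_⟩
  simp at h
  linear_combination h

namespace Split

/-- Over the residue field `a x² + b y²` takes the value `1`; for integer lifts of `x` and `y` the
value is then a `p`-adic square by Hensel. -/
lemma of_units (hp2 : p ≠ 2) {a b : ℤ} (ha : ¬ (p : ℤ) ∣ a) (hb : ¬ (p : ℤ) ∣ b) :
    Split (a : ℚ_[p]) b := by
  rw [← ZMod.intCast_zmod_eq_zero_iff_dvd] at ha hb
  obtain ⟨x, y, h⟩ := exists_sq_add_mul_sq_eq_one hp2 ha hb
  obtain ⟨x, rfl⟩ := ZMod.intCast_surjective x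
  obtain ⟨y, rfl⟩ := ZMod.intCast_surjective y
  have h1 : ((a * x ^ 2 + b * y ^ 2 : ℤ) : ZMod p) = 1 := by push_cast; exact h
  obtain ⟨z, hz⟩ := isSquare_padic_of_isSquare_zmod (p := p) hp2 (a := a * x ^ 2 + b * y ^ 2)
    (by rw [← ZMod.intCast_zmod_eq_zero_iff_dvd, h1]; exact one_ne_zero) (by rw [h1]; exact ⟨1, by simp⟩)
  refine ⟨x, y, z, ?_, by push_cast at hz; rw [hz]; ring⟩
  by_contra! hc
  obtain ⟨h2, h3, -⟩ := hc
  norm_cast at h2 h3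
  subst h2 h3
  simp at h1

lemma of_isSquare_zmod (hp2 : p ≠ 2) {a : ℤ} {b : ℚ_[p]} (ha : ¬ (p : ℤ) ∣ a)
    (h : IsSquare (a : ZMod p)) : Split (a : ℚ_[p]) b :=
  of_isSquare_left (isSquare_padic_of_isSquare_zmod hp2 ha h)

/-- Modulo `p` a primitive solution satisfies `a x² = z²`. If `p ∣ x`, then `p ∣ z`, and since `p`
divides `b` only once also `p ∣ y`, against primitivity. -/
lemma isSquare_zmod {a b : ℤ} (h : Split (a : ℚ_[p]) b) (hb : (p : ℤ) ∣ b)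
    (hb2 : ¬ (p : ℤ) ^ 2 ∣ b) : IsSquare (a : ZMod p) := by
  obtain ⟨x, y, z, h1, h⟩ := h.exists_primitive
  have hz := congrArg PadicInt.toZMod h
  simp only [map_add, map_mul, map_pow, map_intCast] at hz
  rw [(ZMod.intCast_zmod_eq_zero_iff_dvd b p).2 hb] at hz
  by_cases hx : PadicInt.toZMod x = 0
  · exfalso
    have hz0 : PadicInt.toZMod z = 0 := by
      rw [hx] at hz
      simpa using hz.symm
    have hmem : ∀ w : ℤ_[p], PadicInt.toZMod w = 0 → (p : ℤ_[p]) ∣ w := fun w hw => by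
      have : w ∈ RingHom.ker (PadicInt.toZMod (p := p)) := hw
      rwa [PadicInt.ker_toZMod, PadicInt.maximalIdeal_eq_span_p, Ideal.mem_span_singleton] at this
    obtain ⟨x', rfl⟩ := hmem x hx
    obtain ⟨z', rfl⟩ := hmem z hz0
    obtain ⟨b', rfl⟩ := hb
    have hp0 : (p : ℤ_[p]) ≠ 0 := by exact_mod_cast hp.out.ne_zero
    have hy : (b' : ℤ_[p]) * y ^ 2 = p * (z' ^ 2 - a * x' ^ 2) := by
      apply mul_left_cancel₀ hp0
      push_cast at h
      linear_combination h
    have hb' : ¬ (p : ℤ) ∣ b' := fun hc => hb2 (by rw [sq]; exact mul_dvd_mul_left _ hc)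
    have hz2 := congrArg PadicInt.toZMod hy
    simp only [map_mul, map_pow, map_intCast, map_natCast, CharP.cast_eq_zero, zero_mul,
      mul_eq_zero, ZMod.intCast_zmod_eq_zero_iff_dvd, hb', false_or] at hz2
    have hy0 : PadicInt.toZMod y = 0 := by simpa using hz2
    rcases h1 with h1 | h1 | h1
    · rw [h1] at hx; simp at hx
    · rw [h1] at hy0; simp at hy0
    · rw [h1] at hz0; simp at hz0
  · refine ⟨PadicInt.toZMod z / PadicInt.toZMod x, ?_⟩
    field_simp
    linear_combination hz

end Split

end Padic

/-! ### Legendre's theorem by descent -/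

lemma ZMod.isSquare_intCast_of_squarefree (a : ℤ) {n : ℕ} (hn : Squarefree n)
    (h : ∀ p : ℕ, p.Prime → p ∣ n → IsSquare (a : ZMod p)) : IsSquare (a : ZMod n) := by
  induction n using Nat.recOnPosPrimePosCoprime with
  | zero => simp at hn
  | one => exact ⟨0, Subsingleton.elim _ _⟩
  | prime_pow p k hp hk =>
    have hk1 : k = 1 := by
      by_contra hk1
      have h2 : p * p ∣ p ^ k := by rw [← sq]; exact pow_dvd_pow p (by omega)
      exact hp.not_isUnit (hn p h2)
    subst hk1
    rw [pow_one] at h ⊢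
    exact h p hp dvd_rfl
  | coprime m n hm hn' hmn ihm ihn =>
    obtain ⟨r, hr⟩ := ihm (hn.squarefree_of_dvd (dvd_mul_right _ _))
      fun p hp hd => h p hp (hd.mul_right _)
    obtain ⟨s, hs⟩ := ihn (hn.squarefree_of_dvd (dvd_mul_left _ _))
      fun p hp hd => h p hp (hd.mul_left _)
    let e := ZMod.chineseRemainder hmn
    refine ⟨e.symm (r, s), e.injective ?_⟩
    rw [map_mul, RingEquiv.apply_symm_apply, map_intCast]
    ext <;> simp [hr, hs]

lemma Int.exists_sq_mul_squarefree {n : ℤ} (hn : n ≠ 0) :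
    ∃ c m : ℤ, c ≠ 0 ∧ m ≠ 0 ∧ Squarefree m ∧ n = m * c ^ 2 := by
  obtain ⟨a, b, h, ha⟩ := Nat.sq_mul_squarefree n.natAbs
  have hb : b ≠ 0 := by
    rintro rfl
    simp [eq_comm, hn] at h
  refine ⟨b, n.sign * a, by exact_mod_cast hb, mul_ne_zero (by simpa using hn)
    (by exact_mod_cast ha.ne_zero), ?_, ?_⟩
  · rw [← Int.squarefree_natAbs, Int.natAbs_mul, Int.natAbs_sign_of_ne_zero hn, one_mul]
    simpa using ha
  · conv_lhs => rw [← Int.sign_mul_natAbs n, ← h]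
    push_cast
    ring

/-- The balanced residue is used as the square root; the resulting size bound is what makes the
descent terminate. -/
lemma Int.exists_sq_sub_eq_mul {a b : ℤ} (hb : b ≠ 0) (h : IsSquare (a : ZMod b.natAbs)) :
    ∃ t c : ℤ, t ^ 2 - a = b * c ∧ 2 * |t| ≤ |b| := by
  obtain ⟨r, hr⟩ := h
  obtain ⟨r, rfl⟩ := ZMod.intCast_surjective r
  have hd : b ∣ r ^ 2 - a := by
    rw [← Int.natAbs_dvd, ← ZMod.intCast_zmod_eq_zero_iff_dvd]
    push_cast
    rw [hr]; ring
  have hpos : 0 < b.natAbs := Int.natAbs_pos.2 hb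
  refine ⟨Int.bmod r b.natAbs, ?_⟩
  have h1 : b ∣ r - Int.bmod r b.natAbs := by
    rw [← Int.natAbs_dvd]
    exact Int.dvd_self_sub_bmod
  have h2 : b ∣ (Int.bmod r b.natAbs) ^ 2 - a := by
    have : (Int.bmod r b.natAbs) ^ 2 - a = (r ^ 2 - a) -
      (r - Int.bmod r b.natAbs) * (r + Int.bmod r b.natAbs) := by ring
    rw [this]
    exact dvd_sub hd (h1.mul_right _)
  obtain ⟨c, hc⟩ := h2
  refine ⟨c, hc, ?_⟩
  have h3 := Int.le_bmod (x := r) hpos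
  have h4 := Int.bmod_lt (x := r) hpos
  rw [Int.abs_eq_natAbs b, ← abs_two, ← abs_mul, abs_le]
  omega

namespace Split

/-- Legendre's theorem in the form of a local-global principle; the prime `2` can be omitted. -/
theorem of_forall_odd_prime {a b : ℤ} (ha : a ≠ 0) (hb : b ≠ 0) (hs : ¬ (a < 0 ∧ b < 0))
    (h : ∀ (p : ℕ) [Fact p.Prime], p ≠ 2 → Split (a : ℚ_[p]) b) : Split (a : ℚ) b := by
  induction hn : a.natAbs + b.natAbs using Nat.strong_induction_on generalizing a b with
  | _ n ih =>
  subst hn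
  wlog hab : a.natAbs ≤ b.natAbs generalizing a b
  · refine (this hb ha (by tauto) (fun p _ hp2 => (h p hp2).symm) ?_ (by omega)).symm
    intro m hm
    exact ih m (by omega)
  by_cases hsq : Squarefree a ∧ Squarefree b
  swap
  · obtain ⟨c, a', hc, ha', ha's, rfl⟩ := Int.exists_sq_mul_squarefree ha
    obtain ⟨d, b', hd, hb', hb's, rfl⟩ := Int.exists_sq_mul_squarefree hb
    have hcQ : ∀ {K : Type} [Field K] [CharZero K], Split ((a' * c ^ 2 : ℤ) : K) (b' * d ^ 2 : ℤ) ↔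
        Split (a' : K) b' := by
      intro K _ _
      push_cast
      rw [mul_sq_iff (by exact_mod_cast hd), comm, mul_sq_iff (by exact_mod_cast hc), comm]
    rw [hcQ]
    have hc2 : 0 < c ^ 2 := by positivity
    have hd2 : 0 < d ^ 2 := by positivity
    refine ih _ ?_ ha' hb' ?_ (fun p _ hp2 => hcQ.1 (h p hp2)) rfl
    · simp only [Int.natAbs_mul]
      have h1 : 1 ≤ (c ^ 2).natAbs := by omega
      have h2 : 1 ≤ (d ^ 2).natAbs := by omega
      have h3 : 1 ≤ a'.natAbs := by omega
      have h4 : 1 ≤ b'.natAbs := by omega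
      by_cases h5 : (c ^ 2).natAbs = 1
      · by_cases h6 : (d ^ 2).natAbs = 1
        · have h5' : c ^ 2 = 1 := by omega
          have h6' : d ^ 2 = 1 := by omega
          rw [h5', h6', mul_one, mul_one] at hsq
          exact absurd ⟨ha's, hb's⟩ hsq
        · rw [h5]
          have h7 : 2 ≤ (d ^ 2).natAbs := by omega
          nlinarith
      · have h7 : 2 ≤ (c ^ 2).natAbs := by omega
        nlinarith
    · rintro ⟨h1, h2⟩
      exact hs ⟨mul_neg_of_neg_of_pos h1 hc2, mul_neg_of_neg_of_pos h2 hd2⟩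
  obtain ⟨has, hbs⟩ := hsq
  by_cases hb1 : b.natAbs = 1
  · have ha1 : a.natAbs = 1 := by omega
    by_cases ha0 : 0 < a
    · obtain rfl : a = 1 := by omega
      exact of_isSquare_left ⟨1, by simp⟩
    · obtain rfl : b = 1 := by omega
      exact of_isSquare_right ⟨1, by simp⟩
  have hsqm : IsSquare (a : ZMod b.natAbs) := by
    refine ZMod.isSquare_intCast_of_squarefree a (Int.squarefree_natAbs.2 hbs) fun p hp hd => ?_
    have := Fact.mk hp
    -- Every residue modulo `2` is a square, so the descent needs no hypothesis at `2`.
    by_cases hp2 : p = 2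
    · subst hp2
      generalize (a : ZMod 2) = x
      revert x
      decide
    have hd' : (p : ℤ) ∣ b := Int.natCast_dvd.2 hd
    refine (h p hp2).isSquare_zmod hd' fun hd2 => ?_
    rw [sq] at hd2
    exact (Nat.prime_iff_prime_int.1 hp).not_isUnit (hbs _ hd2)
  obtain ⟨t, c, htc, ht⟩ := Int.exists_sq_sub_eq_mul hb hsqm
  by_cases hta : t ^ 2 - a = 0
  · refine of_isSquare_left ⟨t, ?_⟩
    have : a = t * t := by linarith
    exact_mod_cast this
  have hc : c ≠ 0 := by
    rintro rfl
    simp [htc] at hta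
  -- `b c = t² - a` is a norm from `K(√a)`, so `b` and `c` differ by a norm and a square, and `c`
  -- can replace the larger `b`.
  have hiff : ∀ {K : Type} [Field K] [CharZero K], Split (a : K) c ↔ Split (a : K) b := by
    intro K _ _
    have h1 : (t : K) ^ 2 - a * 1 ^ 2 = b * c := by
      have := congrArg (Int.cast : ℤ → K) htc
      push_cast at this
      linear_combination this
    rw [← mul_norm_iff (b := (b : K)) (s := (t : K)) (t := 1), h1,
      ← mul_sq_iff (b := (c : K)) (c := (b : K)) (by exact_mod_cast hb)]
    · ring_nf
    · rw [h1]
      exact_mod_cast mul_ne_zero hb hc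
  rw [← hiff]
  refine ih _ ?_ ha hc ?_ (fun p _ hp2 => hiff.2 (h p hp2)) rfl
  · have h1 : |c| < |b| := by
      have h2 : |b| * |c| ≤ |t| ^ 2 + |a| := by
        rw [← abs_mul, ← htc, sq_abs]
        have := abs_sub (t ^ 2) a
        rwa [abs_of_nonneg (sq_nonneg t)] at this
      have h3 : 2 ≤ |b| := by rw [Int.abs_eq_natAbs]; omega
      have h4 : |a| ≤ |b| := by rw [Int.abs_eq_natAbs, Int.abs_eq_natAbs]; omega
      have h5 := abs_nonneg t
      by_contra! h6
      nlinarith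
    rw [Int.abs_eq_natAbs, Int.abs_eq_natAbs] at h1
    omega
  · rintro ⟨h1, h2⟩
    have hb0 : 0 < b := by
      by_contra hb0
      exact hs ⟨h1, by omega⟩
    have : b * c < 0 := mul_neg_of_pos_of_neg hb0 h2
    nlinarith [sq_nonneg t]

end Split

/-! ### Reciprocity and the auxiliary prime -/

open NumberTheorySymbols in
lemma jacobiSym_eq_jacobiSym_neg {q M : ℕ} (hq : q % 4 = 3) (hM : Odd M) :
    J(M | q) = J(-q | M) := by
  have hqo : Odd q := Nat.odd_iff.2 (by omega)
  rw [jacobiSym.neg _ hM]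
  rcases Nat.odd_mod_four_iff.1 (Nat.odd_iff.1 hM) with h | h
  · rw [ZMod.χ₄_nat_one_mod_four h, one_mul, jacobiSym.quadratic_reciprocity_one_mod_four h hqo]
  · rw [ZMod.χ₄_nat_three_mod_four h, neg_one_mul,
      jacobiSym.quadratic_reciprocity_three_mod_four h hq]

open NumberTheorySymbols in
lemma jacobiSym_eq_one_of_forall_prime {c : ℤ} {n : ℕ} (hn : n ≠ 0)
    (h : ∀ p : ℕ, p.Prime → p ∣ n → J(c | p) = 1) : J(c | n) = 1 := by
  induction n using Nat.recOnMul with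
  | zero => exact absurd rfl hn
  | one => exact jacobiSym.one_right c
  | prime p hp => exact h p hp dvd_rfl
  | mul m n ihm ihn =>
    have hm : m ≠ 0 := left_ne_zero_of_mul hn
    have hn' : n ≠ 0 := right_ne_zero_of_mul hn
    rw [jacobiSym.mul_right' c hm hn', ihm hm fun p hp hd => h p hp (hd.mul_right _),
      ihn hn' fun p hp hd => h p hp (hd.mul_left _), one_mul]

lemma ZMod.isSquare_intCast_iff_jacobiSym {p : ℕ} [hp : Fact p.Prime] {c : ℤ}
    (hc : ¬ (p : ℤ) ∣ c) : IsSquare (c : ZMod p) ↔ jacobiSym c p = 1 := by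
  rw [← jacobiSym.legendreSym.to_jacobiSym,
    legendreSym.eq_one_iff p (by rwa [Ne, ZMod.intCast_zmod_eq_zero_iff_dvd])]

lemma zmod_eight_of_isotropic : ∀ A ∈ ({1, 3, 5, 7} : Finset (ZMod 8)),
    ∀ B ∈ ({1, 3, 5, 7} : Finset (ZMod 8)), ∀ X ∈ ({0, 1, 4} : Finset (ZMod 8)),
    ∀ Y ∈ ({0, 1, 4} : Finset (ZMod 8)), ∀ Z ∈ ({0, 1, 4} : Finset (ZMod 8)),
    (X = 1 ∨ Y = 1 ∨ Z = 1) → -A * X + -(2 * B) * Y = Z → A = 7 ∨ A + 2 * B = 7 := by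
  decide

/-- Squares modulo `8` are `0`, `1`, `4`, and a primitive solution has a coordinate with square `1`;
a finite check leaves only `-A` or `-(A + 2B)` congruent to `1`. -/
lemma mod_eight_of_split_two {A B : ℕ} (hA : Odd A) (hB : Odd B)
    (h : Split ((-A : ℤ) : ℚ_[2]) (-(2 * B) : ℤ)) : A % 8 = 7 ∨ (A + 2 * B) % 8 = 7 := by
  obtain ⟨x, y, z, h1, h⟩ := h.exists_primitive
  have hodd : ∀ n : ℕ, Odd n → (n : ZMod 8) ∈ ({1, 3, 5, 7} : Finset (ZMod 8)) := by
    intro n hn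
    have h8 : n % 8 = 1 ∨ n % 8 = 3 ∨ n % 8 = 5 ∨ n % 8 = 7 := by
      obtain ⟨k, rfl⟩ := hn; omega
    rw [← ZMod.natCast_mod]
    rcases h8 with h8 | h8 | h8 | h8 <;> rw [h8] <;> decide
  have hsq : ∀ w : ZMod 8, w ^ 2 ∈ ({0, 1, 4} : Finset (ZMod 8)) := by decide
  let f : ℤ_[2] →+* ZMod 8 := PadicInt.toZModPow (p := 2) 3
  have hf := congrArg f h
  simp only [map_add, map_mul, map_pow, map_intCast] at hf
  have key := zmod_eight_of_isotropic A (hodd A hA) B (hodd B hB) _ (hsq (f x)) _ (hsq (f y)) _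
    (hsq (f z)) (by rcases h1 with rfl | rfl | rfl <;> simp) (by push_cast at hf; exact hf)
  have h7 : ∀ n : ℕ, (n : ZMod 8) = 7 → n % 8 = 7 := by
    intro n hn
    have : (n : ZMod 8) = (7 : ℕ) := by rw [hn]; rfl
    exact (ZMod.natCast_eq_natCast_iff' _ _ _).1 this
  rcases key with key | key
  · exact Or.inl (h7 _ key)
  · exact Or.inr (h7 _ (by push_cast; exact key))

open NumberTheorySymbols in
/-- The case of the product formula for Hilbert symbols in which the algebra is ramified at `∞`
and at an even number of odd primes. -/
lemma not_split_two_of_even {A B M : ℕ} (hAB : A.Coprime B) (hM : Odd M) (hm : A * B = 2 * M)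
    (hB : Even B) (hs : J(-(A + B) | M) = 1) : ¬ Split ((-A : ℤ) : ℚ_[2]) (-B : ℤ) := by
  obtain ⟨B, rfl⟩ := hB.two_dvd
  intro h
  have hM' : M = A * B := by
    have : 2 * (A * B) = 2 * M := by rw [← hm]; ring
    omega
  subst hM'
  rw [Nat.odd_mul] at hM
  obtain ⟨hA, hB'⟩ := hM
  have hA0 : A ≠ 0 := hA.pos.ne'
  have hB0 : B ≠ 0 := hB'.pos.ne'
  have hmod := mod_eight_of_split_two hA hB' (by exact_mod_cast h)
  have hc : A.Coprime B := hAB.coprime_mul_left_right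
  have e1 : J(-(A + (2 * B : ℕ)) | A) = J(-2 | A) * J(B | A) := by
    rw [← jacobiSym.mul_left]
    refine jacobiSym.mod_left' ((Int.emod_emod_of_dvd _ dvd_rfl).symm.trans ?_)
    rw [Int.emod_emod_of_dvd _ dvd_rfl]
    refine Int.ModEq.symm ?_
    rw [Int.modEq_iff_dvd]
    exact ⟨-1, by push_cast; ring⟩
  have e2 : J(-(A + (2 * B : ℕ)) | B) = ZMod.χ₄ B * J(A | B) := by
    rw [← jacobiSym.neg _ hB']
    refine jacobiSym.mod_left' ?_
    refine Int.ModEq.symm ?_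
    rw [Int.modEq_iff_dvd]
    exact ⟨-2, by push_cast; ring⟩
  -- Reciprocity evaluates the symbol from the residues of `A` and `B` modulo `8`; in the cases
  -- allowed by `hmod` the value is `-1`.
  rw [jacobiSym.mul_right' _ hA0 hB0, e1, e2, jacobiSym.at_neg_two hA,
    ← jacobiSym.quadratic_reciprocity_if (Nat.odd_iff.1 hA) (Nat.odd_iff.1 hB')] at hs
  have hsq : J(B | A) = 1 ∨ J(B | A) = -1 :=
    jacobiSym.eq_one_or_neg_one (by simpa using hc.symm)
  have hA8 := Nat.odd_iff.1 hA
  have hB2 := Nat.odd_iff.1 hB'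
  rw [ZMod.χ₄_nat_eq_if_mod_four, ZMod.χ₈'_nat_eq_if_mod_eight] at hs
  have hBo : ¬ B % 2 = 0 := by omega
  have hAo : ¬ A % 2 = 0 := by omega
  rw [if_neg hBo, if_neg hAo] at hs
  split_ifs at hs <;> first | omega | (rcases hsq with hsq | hsq <;> rw [hsq] at hs <;> omega)

lemma Nat.dvd_of_squarefree_of_prime_dvd {m n : ℕ} (hm : Squarefree m) (hn : n ≠ 0)
    (h : ∀ p : ℕ, p.Prime → p ∣ m → p ∣ n) : m ∣ n := by
  rw [← Nat.prod_primeFactors_of_squarefree hm]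
  refine (Finset.prod_dvd_prod_of_subset _ n.primeFactors _ fun p hp => ?_).trans
    (Nat.prod_primeFactors_dvd n)
  rw [Nat.mem_primeFactors] at hp ⊢
  exact ⟨hp.1, h p hp.1 hp.2.1, hn⟩

lemma Nat.exists_odd_of_squarefree {n : ℕ} (hn : Squarefree n) :
    ∃ f m : ℕ, f ≤ 1 ∧ Odd m ∧ n = 2 ^ f * m := by
  obtain ⟨f, m, hm, h⟩ := Nat.exists_eq_two_pow_mul_odd hn.ne_zero
  refine ⟨f, m, ?_, hm, h⟩
  by_contra! hf
  have h2 : 2 * 2 ∣ n := by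
    rw [h, ← sq]
    exact (pow_dvd_pow 2 hf).mul_right m
  exact Nat.prime_two.not_isUnit (hn 2 h2)

open NumberTheorySymbols in
lemma jacobiSym_neg_two_pow_mul {q f M : ℕ} (hq : q % 4 = 3) (hM : Odd M) :
    J(-(2 ^ f * M : ℕ) | q) = -(J(2 | q) ^ f * J(-q | M)) := by
  have hqo : Odd q := Nat.odd_iff.2 (by omega)
  rw [jacobiSym.neg _ hqo, ZMod.χ₄_nat_three_mod_four hq, neg_one_mul, Nat.cast_mul,
    jacobiSym.mul_left, jacobiSym_eq_jacobiSym_neg hq hM, Nat.cast_pow, jacobiSym.pow_left]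
  rfl

open NumberTheorySymbols in
-- Let `s = J(-(A + B) | M)`. If `q ≡ A + B` modulo `M` and `q ≡ 3` modulo `4`, reciprocity gives
-- `J(-AB | q) = -J(2 | q)^f s`. The same holds for `N` with its own power of `2`, because the odd
-- primes of `AB` not dividing `N` contribute `1` to `s`. Choosing `q` modulo `8` fixes `J(2 | q)`
-- so that both symbols are `1`; when `s = 1` this needs a factor `2` in both `AB` and `N`, which is
-- `h3`.
lemma exists_auxiliary_prime {A B N M f : ℕ} (hm : Squarefree (A * B)) (hN : Squarefree N)
    (hf : f ≤ 1) (hM : Odd M) (hABM : A * B = 2 ^ f * M)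
    (h1 : ∀ p : ℕ, p.Prime → p ≠ 2 → p ∣ N → p ∣ A * B)
    (h2 : ∀ p : ℕ, p.Prime → p ≠ 2 → p ∣ A * B → (J(-(A + B) | p) = 1 ↔ ¬ p ∣ N))
    (h3 : J(-(A + B) | M) = 1 → Even N ∧ f = 1) :
    ∃ q : ℕ, q.Prime ∧ q % 4 = 3 ∧ ¬ q ∣ A * B * N ∧ q ≡ A + B [MOD M] ∧
      J(-(A * B : ℕ) | q) = 1 ∧ J(-N | q) = 1 := by
  have hM0 : M ≠ 0 := hM.pos.ne'
  have hcop : (A + B).Coprime M := by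
    have hc : A.Coprime B := Nat.coprime_of_squarefree_mul hm
    have : (A + B).Coprime (A * B) :=
      Nat.Coprime.mul_right (by simpa using hc.symm) (by simpa using hc)
    exact this.coprime_dvd_right ⟨2 ^ f, by rw [hABM, mul_comm]⟩
  have key : ∀ r : ℕ, r.Coprime 8 → ∃ q : ℕ, q.Prime ∧ ¬ q ∣ A * B * N ∧ q ≡ A + B [MOD M] ∧
      q % 8 = r % 8 := by
    intro r hr
    have h8 : M.Coprime 8 := by
      have : (8 : ℕ) = 2 ^ 3 := rfl
      rw [this]
      exact Nat.Coprime.pow_right _ (Nat.coprime_two_right.2 hM)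
    obtain ⟨k, hk1, hk2⟩ := Nat.chineseRemainder h8 (A + B) r
    have hk : k.Coprime (M * 8) := by
      refine Nat.Coprime.mul_right ?_ ?_
      · rw [Nat.Coprime, hk1.gcd_eq]; exact hcop
      · rw [Nat.Coprime, hk2.gcd_eq]; exact hr
    obtain ⟨q, hq1, hq2, hq3⟩ := Nat.forall_exists_prime_gt_and_modEq (A * B * N)
      (mul_ne_zero hM0 (by norm_num)) hk
    refine ⟨q, hq2, ?_, (hq3.of_mul_right _).trans hk1, (hq3.of_mul_left _).trans hk2⟩
    exact Nat.not_dvd_of_pos_of_lt (Nat.pos_of_ne_zero (mul_ne_zero hm.ne_zero hN.ne_zero)) hq1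
  have hJ : ∀ q : ℕ, q ≡ A + B [MOD M] → J(-q | M) = J(-(A + B) | M) := fun q hq =>
    jacobiSym.mod_left' (Int.ModEq.neg (by exact_mod_cast (Int.natCast_modEq_iff.2 hq)))
  obtain ⟨e, N', he, hN', rfl⟩ := Nat.exists_odd_of_squarefree hN
  have hN'sq : Squarefree N' := hN.squarefree_of_dvd (dvd_mul_left _ _)
  have hodd : ∀ {p n : ℕ}, Odd n → p ∣ n → p ≠ 2 := by
    rintro p n hn hd rfl
    exact (Nat.not_even_iff_odd.2 hn) (even_iff_two_dvd.2 hd)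
  have hdvd : N' ∣ M := by
    refine Nat.dvd_of_squarefree_of_prime_dvd hN'sq hM0 fun p hp hd => ?_
    have hp2 : p ≠ 2 := hodd hN' hd
    have := h1 p hp hp2 (hd.mul_left _)
    rw [hABM] at this
    exact (hp.dvd_mul.1 this).resolve_left fun h =>
      hp2 ((Nat.prime_dvd_prime_iff_eq hp Nat.prime_two).1 (hp.dvd_of_dvd_pow h))
  have hJN : ∀ q : ℕ, q ≡ A + B [MOD M] → J(-q | N') = J(-(A + B) | M) := by
    intro q hq
    rw [← hJ q hq]
    obtain ⟨M', rfl⟩ := hdvd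
    have hM'0 : M' ≠ 0 := right_ne_zero_of_mul hM0
    rw [jacobiSym.mul_right' _ hN'.pos.ne' hM'0]
    suffices J(-q | M') = 1 by rw [this, mul_one]
    refine jacobiSym_eq_one_of_forall_prime hM'0 fun p hp hd => ?_
    have hp2 : p ≠ 2 := hodd (Nat.odd_mul.1 hM).2 hd
    have hdm : p ∣ A * B := by rw [hABM]; exact (hd.mul_left _).mul_left _
    have e1 : J(-q | p) = J(-(A + B) | p) := by
      refine jacobiSym.mod_left' (Int.ModEq.neg ?_)
      exact_mod_cast (Int.natCast_modEq_iff.2 (hq.of_dvd (hd.mul_left _)))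
    rw [e1, h2 p hp hp2 hdm]
    intro hpN
    have hpN' : p ∣ N' := (hp.dvd_mul.1 hpN).resolve_left fun h =>
      hp2 ((Nat.prime_dvd_prime_iff_eq hp Nat.prime_two).1 (hp.dvd_of_dvd_pow h))
    have hsq : Squarefree (2 ^ f * (N' * M')) := hABM ▸ hm
    exact hp.not_isUnit (hsq p ((mul_dvd_mul hpN' hd).mul_left _))
  have hs : J(-(A + B) | M) = 1 ∨ J(-(A + B) | M) = -1 := by
    refine jacobiSym.eq_one_or_neg_one ?_
    rw [Int.neg_gcd]
    exact_mod_cast hcop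
  rcases hs with hs | hs
  · obtain ⟨hNe, rfl⟩ := h3 hs
    have he1 : e = 1 := by
      rcases Nat.le_one_iff_eq_zero_or_eq_one.1 he with rfl | rfl
      · rw [pow_zero, one_mul] at hNe
        exact absurd hNe (Nat.not_even_iff_odd.2 hN')
      · rfl
    subst he1
    -- Here the sign must come from `2`, and `J(2 | q) = -1` for `q ≡ 3` modulo `8`.
    obtain ⟨q, hq1, hq2, hq3, hq4⟩ := key 3 (by norm_num)
    have hq : q % 4 = 3 := by omega
    have hJ2 : J(2 | q) = -1 := by
      rw [jacobiSym.at_two (Nat.odd_iff.2 (by omega)), ZMod.χ₈_nat_eq_if_mod_eight]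
      rw [if_neg (by omega), if_neg (by omega)]
    refine ⟨q, hq1, hq, hq2, hq3, ?_, ?_⟩
    · rw [hABM, jacobiSym_neg_two_pow_mul hq hM, hJ q hq3, hs, hJ2]; norm_num
    · rw [jacobiSym_neg_two_pow_mul hq hN', hJN q hq3, hs, hJ2]; norm_num
  -- Here `s = -1` already supplies the sign, and `q ≡ 7` modulo `8` makes `J(2 | q) = 1`.
  · obtain ⟨q, hq1, hq2, hq3, hq4⟩ := key 7 (by norm_num)
    have hq : q % 4 = 3 := by omega
    have hJ2 : J(2 | q) = 1 := by
      rw [jacobiSym.at_two (Nat.odd_iff.2 (by omega)), ZMod.χ₈_nat_eq_if_mod_eight]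
      rw [if_neg (by omega), if_pos (by omega)]
    refine ⟨q, hq1, hq, hq2, hq3, ?_, ?_⟩
    · rw [hABM, jacobiSym_neg_two_pow_mul hq hM, hJ q hq3, hs, hJ2]; norm_num
    · rw [jacobiSym_neg_two_pow_mul hq hN', hJN q hq3, hs, hJ2]; norm_num

open NumberTheorySymbols in
-- If `p ∣ B`, then `-(A + B) ≡ -A` modulo `p`, and the form is isotropic exactly when `-A` is a
-- square modulo `p`. Using `A + B` treats the primes of `A` and of `B` uniformly.
lemma jacobiSym_neg_add_eq_one_iff {A B p : ℕ} [hp : Fact p.Prime] (hm : Squarefree (A * B))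
    (hp2 : p ≠ 2) (hd : p ∣ A * B) :
    J(-(A + B) | p) = 1 ↔ Split ((-A : ℤ) : ℚ_[p]) (-B : ℤ) := by
  wlog hB : p ∣ B generalizing A B
  · rw [add_comm, Split.comm]
    exact this (by rwa [mul_comm]) (by rwa [mul_comm]) ((hp.out.dvd_mul.1 hd).resolve_right hB)
  have hc : A.Coprime B := Nat.coprime_of_squarefree_mul hm
  have hA : ¬ (p : ℤ) ∣ -A := by
    rw [dvd_neg, Int.natCast_dvd_natCast]
    exact fun h => hp.out.not_isUnit (Nat.isUnit_iff.2 (Nat.eq_one_of_dvd_coprimes hc h hB))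
  have e1 : J(-(A + B) | p) = J(-A | p) := by
    refine jacobiSym.mod_left' (Int.ModEq.neg (Int.modEq_iff_dvd.2 ?_))
    have : (p : ℤ) ∣ B := Int.natCast_dvd_natCast.2 hB
    simpa using this
  rw [e1, ← ZMod.isSquare_intCast_iff_jacobiSym hA]
  refine ⟨Split.of_isSquare_zmod hp2 hA, fun h => h.isSquare_zmod ?_ ?_⟩
  · rw [dvd_neg]; exact_mod_cast hB
  · rw [dvd_neg]
    norm_cast
    rw [sq]
    exact fun h => hp.out.not_isUnit (hm p (h.trans (dvd_mul_left _ _)))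

/-- If `p ∣ B`, then `A q ≡ A²` modulo `p`. -/
lemma Split.mul_of_modEq {A B p q : ℕ} [hp : Fact p.Prime] (hm : Squarefree (A * B))
    (hp2 : p ≠ 2) (hd : p ∣ A * B) (hpq : ¬ p ∣ q) (hq : q ≡ A + B [MOD p]) :
    Split ((A * q : ℕ) : ℚ_[p]) (B * q : ℕ) := by
  wlog hB : p ∣ B generalizing A B
  · refine (this (by rwa [mul_comm]) (by rwa [mul_comm]) (by rwa [add_comm])
      ((hp.out.dvd_mul.1 hd).resolve_right hB)).symm
  have hc : A.Coprime B := Nat.coprime_of_squarefree_mul hm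
  have hA : ¬ p ∣ A :=
    fun h => hp.out.not_isUnit (Nat.isUnit_iff.2 (Nat.eq_one_of_dvd_coprimes hc h hB))
  have := Split.of_isSquare_zmod (p := p) hp2 (a := (A * q : ℕ)) (b := ((B * q : ℕ) : ℚ_[p])) ?_ ?_
  · simpa using this
  · rw [Int.natCast_dvd_natCast, hp.out.dvd_mul]
    tauto
  · have h1 := (ZMod.natCast_eq_natCast_iff _ _ _).2 hq
    push_cast at h1 ⊢
    rw [h1, (ZMod.natCast_eq_zero_iff B p).2 hB]
    exact ⟨A, by ring⟩

/-- A prime `q` with suitable residues is represented by `A x² + B y²` over `ℚ`. -/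
lemma exists_rat_prime_eq {A B q : ℕ} (hm : Squarefree (A * B)) (hq : q.Prime) (hq2 : q ≠ 2)
    (hqm : ¬ q ∣ A * B) (hmod : ∀ p : ℕ, p.Prime → p ≠ 2 → p ∣ A * B → q ≡ A + B [MOD p])
    (hJ : jacobiSym (-(A * B : ℕ)) q = 1) : ∃ x y : ℚ, (q : ℚ) = A * x ^ 2 + B * y ^ 2 := by
  have hA : A ≠ 0 := left_ne_zero_of_mul hm.ne_zero
  have hB : B ≠ 0 := right_ne_zero_of_mul hm.ne_zero
  have hq0 := hq.ne_zero
  have hsplit : Split (((A * q : ℕ) : ℤ) : ℚ) ((B * q : ℕ) : ℤ) := by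
    refine Split.of_forall_odd_prime (by exact_mod_cast mul_ne_zero hA hq0)
      (by exact_mod_cast mul_ne_zero hB hq0) (by omega) ?_
    intro p hp hp2
    by_cases hpq : p = q
    · subst hpq
      have hqm' : ¬ (p : ℤ) ∣ -(A * B : ℕ) := by
        rw [dvd_neg]; exact_mod_cast hqm
      have hsq := (ZMod.isSquare_intCast_iff_jacobiSym hqm').2 hJ
      -- At `q` itself, `-(Aq)(Bq) = -AB q²` is a `q`-adic square.
      have h1 := Split.of_isSquare_right (a := ((A * p : ℕ) : ℚ_[p]))
        (isSquare_padic_of_isSquare_zmod hp2 hqm' hsq)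
      rw [← Split.mul_sq_iff (c := (p : ℚ_[p])) (by exact_mod_cast hq0)] at h1
      have hAp : ((A * p : ℕ) : ℚ_[p]) ≠ 0 := by exact_mod_cast mul_ne_zero hA hq0
      rw [Int.cast_natCast, Int.cast_natCast, ← Split.neg_mul_iff hAp]
      convert h1 using 1
      push_cast
      ring
    · have hpq' : ¬ p ∣ q := fun h => hpq ((Nat.prime_dvd_prime_iff_eq hp.out hq).1 h)
      by_cases hd : p ∣ A * B
      · simpa using Split.mul_of_modEq hm hp2 hd hpq' (hmod p hp.out hp2 hd)
      · rw [hp.out.dvd_mul, not_or] at hd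
        refine Split.of_units hp2 ?_ ?_ <;>
        · rw [Int.natCast_dvd_natCast, hp.out.dvd_mul]
          tauto
  obtain ⟨x, y, z, h0, h⟩ := hsplit
  have hAQ : (0 : ℚ) < A := by exact_mod_cast Nat.pos_of_ne_zero hA
  have hBQ : (0 : ℚ) < B := by exact_mod_cast Nat.pos_of_ne_zero hB
  have hqQ : (0 : ℚ) < q := by exact_mod_cast hq.pos
  push_cast at h
  have hz : z ≠ 0 := by
    rintro rfl
    have h1 : 0 ≤ (A * q : ℚ) * x ^ 2 := by positivity
    have h2 : 0 ≤ (B * q : ℚ) * y ^ 2 := by positivity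
    have h3 : (A * q : ℚ) * x ^ 2 = 0 := by linarith
    have h4 : (B * q : ℚ) * y ^ 2 = 0 := by linarith
    have h5 : x = 0 := by simpa [hAQ.ne', hqQ.ne'] using h3
    have h6 : y = 0 := by simpa [hBQ.ne', hqQ.ne'] using h4
    tauto
  refine ⟨x * q / z, y * q / z, ?_⟩
  field_simp
  linear_combination -h

/-- The quaternion algebra `(-A, -B / ℚ)` contains a square root of `-N`. -/
lemma exists_rat_rep_of_coprime {A B N : ℕ} (hm : Squarefree (A * B)) (hN : Squarefree N)
    (h : ∀ (p : ℕ) [Fact p.Prime], p ∣ N ↔ ¬ Split ((-A : ℤ) : ℚ_[p]) (-B : ℤ))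
    (hpar : Even (A * B) ∨ A % 4 = 3 ∧ B % 4 = 3) :
    ∃ x y z : ℚ, A * x ^ 2 + B * y ^ 2 + A * B * z ^ 2 = N := by
  have hA : A ≠ 0 := left_ne_zero_of_mul hm.ne_zero
  have hB : B ≠ 0 := right_ne_zero_of_mul hm.ne_zero
  have hc : A.Coprime B := Nat.coprime_of_squarefree_mul hm
  have h1 : ∀ p : ℕ, p.Prime → p ≠ 2 → p ∣ N → p ∣ A * B := by
    intro p hp hp2 hd
    have := Fact.mk hp
    by_contra hd'
    rw [hp.dvd_mul, not_or] at hd'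
    refine (h p).1 hd (Split.of_units hp2 ?_ ?_) <;>
    · rw [dvd_neg, Int.natCast_dvd_natCast]
      tauto
  have h2 : ∀ p : ℕ, p.Prime → p ≠ 2 → p ∣ A * B →
      (jacobiSym (-(A + B)) p = 1 ↔ ¬ p ∣ N) := by
    intro p hp hp2 hd
    have := Fact.mk hp
    rw [jacobiSym_neg_add_eq_one_iff hm hp2 hd, h p, not_not]
  obtain ⟨f, M, hf, hM, hABM⟩ := Nat.exists_odd_of_squarefree hm
  have h3 : jacobiSym (-(A + B)) M = 1 → Even N ∧ f = 1 := by
    intro hs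
    rcases hpar with hpar | ⟨hA4, hB4⟩
    · have hf1 : f = 1 := by
        rcases Nat.le_one_iff_eq_zero_or_eq_one.1 hf with rfl | rfl
        · rw [hABM, pow_zero, one_mul] at hpar
          exact absurd hpar (Nat.not_even_iff_odd.2 hM)
        · rfl
      subst hf1
      refine ⟨even_iff_two_dvd.2 ((h 2).2 ?_), rfl⟩
      rcases Nat.even_mul.1 hpar with he | he
      · rw [Split.comm]
        rw [add_comm] at hs
        exact not_split_two_of_even hc.symm hM (by rw [mul_comm, hABM, pow_one]) he hs
      · exact not_split_two_of_even hc hM (by rw [hABM, pow_one]) he hs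
    -- With `A` and `B` both `3` modulo `4`, reciprocity turns the symbol into minus a square, so it
    -- cannot be `1`.
    · exfalso
      have hAo : Odd A := Nat.odd_iff.2 (by omega)
      have hBo : Odd B := Nat.odd_iff.2 (by omega)
      have hf0 : f = 0 := by
        by_contra hf0
        have : Even (A * B) := by
          rw [hABM]
          exact (Nat.even_pow.2 ⟨even_two, hf0⟩).mul_right _
        exact (Nat.not_even_iff_odd.2 (hAo.mul hBo)) this
      subst hf0
      obtain rfl : A * B = M := by simpa using hABM
      have e1 : jacobiSym (-(A + B)) A = jacobiSym (-B) A := by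
        refine jacobiSym.mod_left' (Int.ModEq.neg (Int.modEq_iff_dvd.2 ?_))
        simp
      have e2 : jacobiSym (-(A + B)) B = jacobiSym (-A) B := by
        refine jacobiSym.mod_left' (Int.ModEq.neg (Int.modEq_iff_dvd.2 ?_))
        simp
      rw [jacobiSym.mul_right' _ hA hB, e1, e2, ← jacobiSym_eq_jacobiSym_neg hA4 hBo, jacobiSym.neg _ hAo,
        ZMod.χ₄_nat_three_mod_four hA4] at hs
      nlinarith [sq_nonneg (jacobiSym B A)]
  obtain ⟨q, hq, hq4, hqd, hqM, hJ1, hJ2⟩ := exists_auxiliary_prime hm hN hf hM hABM h1 h2 h3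
  have hq2 : q ≠ 2 := by rintro rfl; simp at hq4
  rw [hq.dvd_mul, not_or] at hqd
  have hmod : ∀ p : ℕ, p.Prime → p ≠ 2 → p ∣ A * B → q ≡ A + B [MOD p] := by
    intro p hp hp2 hd
    refine hqM.of_dvd ?_
    rw [hABM] at hd
    exact (hp.dvd_mul.1 hd).resolve_left fun h =>
      hp2 ((Nat.prime_dvd_prime_iff_eq hp Nat.prime_two).1 (hp.dvd_of_dvd_pow h))
  obtain ⟨x₁, y₁, hxy⟩ := exists_rat_prime_eq hm hq hq2 hqd.1 hmod hJ1
  -- At `q`, `N A B = (-N)(-AB)` is a square. At odd `p ∣ AB`, either `p ∣ N` and `N A B` is `p²`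
  -- times a unit, or `-q ≡ -(A + B)` is a square. At other odd primes both entries are units.
  have hsplit : Split ((-q : ℤ) : ℚ) ((N * (A * B) : ℕ) : ℤ) := by
    refine Split.of_forall_odd_prime (by simpa using hq.ne_zero)
      (by exact_mod_cast mul_ne_zero hN.ne_zero hm.ne_zero) (by omega) ?_
    intro p hp hp2
    by_cases hpq : p = q
    · subst hpq
      have hnd : ¬ (p : ℤ) ∣ (N * (A * B) : ℕ) := by
        rw [Int.natCast_dvd_natCast, hq.dvd_mul]; tauto
      refine Split.of_isSquare_right (isSquare_padic_of_isSquare_zmod hp2 hnd ?_)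
      rw [ZMod.isSquare_intCast_iff_jacobiSym hnd]
      have : ((N * (A * B) : ℕ) : ℤ) = (-N) * (-(A * B : ℕ)) := by push_cast; ring
      rw [this, jacobiSym.mul_left, hJ1, hJ2, one_mul]
    have hpq' : ¬ (p : ℤ) ∣ -q := by
      rw [dvd_neg, Int.natCast_dvd_natCast]
      exact fun h => hpq ((Nat.prime_dvd_prime_iff_eq hp.out hq).1 h)
    by_cases hd : p ∣ A * B
    · by_cases hpN : p ∣ N
      · obtain ⟨m', hm'⟩ := hd
        obtain ⟨N', rfl⟩ := hpN
        have hpm : ¬ p ∣ m' := fun hc => hp.out.not_isUnit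
          (hm p (hm' ▸ mul_dvd_mul_left p hc))
        have hpN' : ¬ p ∣ N' := fun hc => hp.out.not_isUnit (hN p (mul_dvd_mul_left p hc))
        have hu : ¬ (p : ℤ) ∣ (N' * m' : ℕ) := by
          rw [Int.natCast_dvd_natCast, hp.out.dvd_mul]; tauto
        have h5 := Split.of_units hp2 hpq' hu
        rw [← Split.mul_sq_iff (c := (p : ℚ_[p])) (by exact_mod_cast hp.out.ne_zero)] at h5
        rw [hm']
        convert h5 using 1
        push_cast
        ring
      · have h5 := (h2 p hp.out hp2 hd).2 hpN
        refine Split.of_isSquare_zmod hp2 hpq' ?_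
        rw [ZMod.isSquare_intCast_iff_jacobiSym hpq', ← h5]
        refine jacobiSym.mod_left' (Int.ModEq.neg ?_)
        exact_mod_cast (Int.natCast_modEq_iff.2 (hmod p hp.out hp2 hd))
    · refine Split.of_units hp2 hpq' ?_
      rw [Int.natCast_dvd_natCast, hp.out.dvd_mul]
      have := h1 p hp.out hp2
      tauto
  obtain ⟨x, y, z, h0, h⟩ := hsplit
  have hAQ : (0 : ℚ) < A := by exact_mod_cast Nat.pos_of_ne_zero hA
  have hBQ : (0 : ℚ) < B := by exact_mod_cast Nat.pos_of_ne_zero hB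
  have hqQ : (0 : ℚ) < q := by exact_mod_cast hq.pos
  push_cast at h
  have hy : y ≠ 0 := by
    rintro rfl
    have h1 : 0 ≤ (q : ℚ) * x ^ 2 := by positivity
    have h2 : 0 ≤ z ^ 2 := by positivity
    have h3 : (q : ℚ) * x ^ 2 = 0 := by linarith
    have h4 : z ^ 2 = 0 := by linarith
    have h5 : x = 0 := by simpa [hqQ.ne'] using h3
    have h6 : z = 0 := by simpa using h4
    tauto
  -- Divide `N A B y² = z² + q x²` by `A B y²` and insert `q = A x₁² + B y₁²`; the factor `1 / (AB)`
  -- exchanges the roles of `x₁` and `y₁`.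
  refine ⟨x * y₁ / (A * y), x * x₁ / (B * y), z / (A * B * y), ?_⟩
  field_simp
  rw [hxy] at h
  linear_combination -h

/-! ### A square root of `-N` in the quaternion algebra -/

/-- The norm form on the trace zero part of `(a, b / ℚ)` represents `N`, as soon as `N` is
squarefree and is divisible by exactly the primes at which `(a, b / ℚ)` does not split. -/
def HasSqrtNegDisc (a b : ℚ) : Prop :=
  ∀ N : ℕ, Squarefree N → (∀ (p : ℕ) [Fact p.Prime], p ∣ N ↔ ¬ Split (a : ℚ_[p]) b) →
    ∃ x y z : ℚ, a * x ^ 2 + b * y ^ 2 - a * b * z ^ 2 = -N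

namespace HasSqrtNegDisc

lemma symm {a b : ℚ} (h : HasSqrtNegDisc a b) : HasSqrtNegDisc b a := by
  intro N hN hs
  obtain ⟨x, y, z, hxyz⟩ := h N hN fun p _ => by rw [Split.comm]; exact hs p
  exact ⟨y, x, z, by rw [← hxyz]; ring⟩

/-- Replacing the generator `j` by `(s + t i) j` gives the same algebra; the new coordinates come
from `(y + z i)(s + t i) j`. -/
lemma of_mul_norm {a b : ℚ} {s t : ℚ} (hn : s ^ 2 - a * t ^ 2 ≠ 0)
    (h : HasSqrtNegDisc a (b * (s ^ 2 - a * t ^ 2))) : HasSqrtNegDisc a b := by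
  intro N hN hs
  obtain ⟨x, y, z, hxyz⟩ := h N hN fun p _ => by
    rw [hs p]
    push_cast
    rw [Split.mul_norm_iff]
    exact_mod_cast hn
  exact ⟨x, s * y + a * t * z, s * z + t * y, by rw [← hxyz]; ring⟩

lemma of_mul_sq {a b c : ℚ} (hc : c ≠ 0) (h : HasSqrtNegDisc a (b * c ^ 2)) :
    HasSqrtNegDisc a b := by
  refine of_mul_norm (s := c) (t := 0) (by simpa using hc) ?_
  simpa using h

lemma mul_sq {a b c : ℚ} (hc : c ≠ 0) (h : HasSqrtNegDisc a b) :
    HasSqrtNegDisc a (b * c ^ 2) := by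
  refine of_mul_sq (inv_ne_zero hc) ?_
  rwa [mul_assoc, ← mul_pow, mul_inv_cancel₀ hc, one_pow, mul_one]

lemma of_coprime {A B : ℕ} (hm : Squarefree (A * B))
    (hpar : Even (A * B) ∨ A % 4 = 3 ∧ B % 4 = 3) : HasSqrtNegDisc (-A) (-B) := by
  intro N hN hs
  obtain ⟨x, y, z, h⟩ := exists_rat_rep_of_coprime hm hN
    (fun p _ => by rw [hs p]; push_cast; rfl) hpar
  exact ⟨x, y, z, by rw [← h]; ring⟩

/-- Replacing `-B` by its product with the norm `1 + A`. -/
lemma of_mod_four_eq_one {A B : ℕ} (hm : Squarefree (A * B)) (hA : A % 4 = 1) (hB : Odd B) :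
    HasSqrtNegDisc (-A) (-B) := by
  have hc : A.Coprime B := Nat.coprime_of_squarefree_mul hm
  have hB0 : B ≠ 0 := right_ne_zero_of_mul hm.ne_zero
  obtain ⟨C, d, hC⟩ := Nat.sq_mul_squarefree (B * (1 + A))
  obtain ⟨hdC, hCsq⟩ := hC
  have hd0 : d ≠ 0 := by
    rintro rfl
    have : B * (1 + A) ≠ 0 := mul_ne_zero hB0 (by omega)
    simp [eq_comm] at hdC
    omega
  have hcC : A.Coprime C := by
    have h1 : A.Coprime (B * (1 + A)) := Nat.Coprime.mul_right hc (by simp)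
    exact h1.coprime_dvd_right ⟨d ^ 2, by rw [← hdC, mul_comm]⟩
  -- `B (1 + A) ≡ 2` modulo `4`, so its squarefree part `C` stays even and `of_coprime` applies to
  -- `A` and `C`.
  have hCe : Even C := by
    have h4 : (B * (1 + A)) % 4 = 2 := by
      obtain ⟨k, rfl⟩ := hB
      have : A = 4 * (A / 4) + 1 := by omega
      rw [this, show (2 * k + 1) * (1 + (4 * (A / 4) + 1)) =
        4 * (k + (2 * k + 1) * (A / 4)) + 2 by ring]
      omega
    by_contra hCo
    rw [Nat.not_even_iff_odd] at hCo
    rcases Nat.even_or_odd d with hd | hd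
    · obtain ⟨e, rfl⟩ := hd
      rw [show (e + e) ^ 2 * C = 4 * (e ^ 2 * C) by ring] at hdC
      omega
    · have := (hd.pow (n := 2)).mul hCo
      rw [hdC, Nat.odd_iff] at this
      omega
  have hmC : Squarefree (A * C) := by
    rw [Nat.squarefree_mul hcC]
    exact ⟨hm.squarefree_of_dvd (dvd_mul_right _ _), hCsq⟩
  have h1 := (of_coprime hmC (Or.inl (hCe.mul_left A))).mul_sq (c := (d : ℚ))
    (by exact_mod_cast hd0)
  refine of_mul_norm (s := 1) (t := 1) ?_ ?_
  · have : (0 : ℚ) ≤ A := Nat.cast_nonneg A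
    intro h
    linarith
  · convert h1 using 1
    have h2 : (d : ℚ) ^ 2 * C = B * (1 + A) := by exact_mod_cast hdC
    linear_combination h2

lemma of_squarefree_mul {A B : ℕ} (hm : Squarefree (A * B)) : HasSqrtNegDisc (-A) (-B) := by
  by_cases hpar : Even (A * B) ∨ A % 4 = 3 ∧ B % 4 = 3
  · exact of_coprime hm hpar
  rw [not_or, Nat.not_even_iff_odd, Nat.odd_mul] at hpar
  obtain ⟨⟨hA, hB⟩, h⟩ := hpar
  by_cases hA4 : A % 4 = 1
  · exact of_mod_four_eq_one hm hA4 hB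
  · refine (of_mod_four_eq_one (by rwa [mul_comm]) ?_ hA).symm
    rw [Nat.odd_iff] at hA hB
    omega

/-- A common factor `g` is removed with the norm `g² + A g = g (g + A)`: it changes `B g` into `g² B
(g + A)`, and `B (g + A)` is coprime to `A g`. -/
lemma of_squarefree {A B : ℕ} (hA : Squarefree A) (hB : Squarefree B) :
    HasSqrtNegDisc (-A) (-B) := by
  obtain ⟨g, A, B, hg, hAB, hA', hB'⟩ : ∃ g A' B' : ℕ, g ≠ 0 ∧ A'.Coprime B' ∧
      A = A' * g ∧ B = B' * g :=
    ⟨A.gcd B, A / A.gcd B, B / A.gcd B, (Nat.gcd_pos_of_pos_left _ (Nat.pos_of_ne_zero hA.ne_zero)).ne',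
      Nat.coprime_div_gcd_div_gcd (Nat.gcd_pos_of_pos_left _ (Nat.pos_of_ne_zero hA.ne_zero)),
      (Nat.div_mul_cancel (Nat.gcd_dvd_left _ _)).symm,
      (Nat.div_mul_cancel (Nat.gcd_dvd_right _ _)).symm⟩
  subst hA' hB'
  have hA0 : A ≠ 0 := left_ne_zero_of_mul hA.ne_zero
  have hB0 : B ≠ 0 := left_ne_zero_of_mul hB.ne_zero
  have hAg : A.Coprime g := Nat.coprime_of_squarefree_mul hA
  have hBg : B.Coprime g := Nat.coprime_of_squarefree_mul hB
  obtain ⟨C, d, hdC, hC⟩ := Nat.sq_mul_squarefree (B * (g + A))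
  have hd0 : d ≠ 0 := by
    rintro rfl
    have : B * (g + A) ≠ 0 := mul_ne_zero hB0 (by omega)
    rw [← hdC] at this
    simp at this
  have hcop : (A * g).Coprime C := by
    have h1 : (A * g).Coprime (B * (g + A)) := by
      refine Nat.Coprime.mul_right (Nat.Coprime.mul_left hAB hBg.symm) ?_
      exact Nat.Coprime.mul_left (by simpa using hAg) (by simpa using hAg.symm)
    exact h1.coprime_dvd_right ⟨d ^ 2, by rw [← hdC, mul_comm]⟩
  have h1 := (of_squarefree_mul ((Nat.squarefree_mul hcop).2 ⟨hA, hC⟩)).mul_sq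
    (c := (d * g : ℚ)) (by exact_mod_cast mul_ne_zero hd0 hg)
  refine of_mul_norm (s := g) (t := 1) ?_ ?_
  · have h2 : (0 : ℚ) < g := by exact_mod_cast Nat.pos_of_ne_zero hg
    have h3 : (0 : ℚ) ≤ (A * g : ℕ) := Nat.cast_nonneg _
    intro h
    nlinarith
  · convert h1 using 1
    have h2 : (d : ℚ) ^ 2 * C = B * (g + A) := by exact_mod_cast hdC
    push_cast
    linear_combination (g : ℚ) ^ 2 * h2

lemma _root_.Rat.exists_squarefree_of_neg {a : ℚ} (ha : a < 0) :
    ∃ (c : ℚ) (A : ℕ), c ≠ 0 ∧ Squarefree A ∧ a * c ^ 2 = -A := by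
  obtain ⟨A, d, hd, hA⟩ := Nat.sq_mul_squarefree (a.num.natAbs * a.den)
  have hnum : a.num < 0 := Rat.num_neg.2 ha
  have hd0 : (d : ℚ) ≠ 0 := by
    intro h
    have h' : d = 0 := by exact_mod_cast h
    subst h'
    have h2 : a.num.natAbs * a.den ≠ 0 := mul_ne_zero (by omega) a.den_ne_zero
    rw [← hd] at h2
    simp at h2
  have hden : (a.den : ℚ) ≠ 0 := by exact_mod_cast a.den_ne_zero
  refine ⟨a.den / d, A, div_ne_zero hden hd0, hA, ?_⟩
  have h1 : (d : ℚ) ^ 2 * A = -a.num * a.den := by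
    have h2 : ((a.num.natAbs : ℤ) : ℚ) = ((-a.num : ℤ) : ℚ) := by
      congr 1
      omega
    have h3 := congrArg (Nat.cast : ℕ → ℚ) hd
    push_cast at h2 h3
    rw [h3, ← h2, Nat.cast_natAbs, Int.cast_abs]
  have h2 : a * a.den = a.num := Rat.mul_den_eq_num a
  field_simp
  linear_combination h1 + a.den * h2

/-- A definite quaternion algebra over `ℚ` of discriminant `N` contains a square root of `-N`. -/
theorem of_neg {a b : ℚ} (ha : a < 0) (hb : b < 0) : HasSqrtNegDisc a b := by
  obtain ⟨c, A, hc, hA, hcA⟩ := Rat.exists_squarefree_of_neg ha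
  obtain ⟨d, B, hd, hB, hdB⟩ := Rat.exists_squarefree_of_neg hb
  refine of_mul_sq hd (symm (of_mul_sq hc ?_))
  rw [hcA, hdB]
  exact (of_squarefree hA hB).symm

end HasSqrtNegDisc

/-! ### The norm absolute value at a ramified prime -/

noncomputable section

/-- The element `x` of `ℍ[K, a, b]` as a unit, when its norm does not vanish. -/
lemma QuaternionAlgebra.isUnit_of_norm_ne_zero {K : Type*} [Field K] {a b : K} (x : ℍ[K, a, b])
    (hx : x.re ^ 2 - a * x.imI ^ 2 - b * x.imJ ^ 2 + a * b * x.imK ^ 2 ≠ 0) : IsUnit x := by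
  set n := x.re ^ 2 - a * x.imI ^ 2 - b * x.imJ ^ 2 + a * b * x.imK ^ 2 with hn
  have h1 : x * star x = (n : ℍ[K, a, b]) := by
    ext <;> simp
    · rw [hn]; ring
    all_goals ring
  have h2 : star x * x = (n : ℍ[K, a, b]) := by
    ext <;> simp
    · rw [hn]; ring
    all_goals ring
  have h3 : n⁻¹ • (n : ℍ[K, a, b]) = 1 := by
    rw [QuaternionAlgebra.smul_coe, inv_mul_cancel₀ hx, QuaternionAlgebra.coe_one]
  exact ⟨⟨x, n⁻¹ • star x, by rw [mul_smul_comm, h1, h3], by rw [smul_mul_assoc, h2, h3]⟩, rfl⟩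

/-- The norm is a norm from `K(√a)` minus `b` times another, so a nonzero quaternion of norm zero
exhibits `b` as a quotient of norms, unless `a` is itself a square. -/
lemma QuaternionAlgebra.forall_isUnit_iff {K : Type*} [Field K] {a b : K} :
    (∀ x : ℍ[K, a, b], x ≠ 0 → IsUnit x) ↔ ¬ Split a b := by
  constructor
  · rintro h ⟨x, y, z, h0, hxyz⟩
    let w : ℍ[K, a, b] := ⟨z, x, y, 0⟩
    have hw : w ≠ 0 := by
      intro hw
      have h1 := congrArg QuaternionAlgebra.re hw
      have h2 := congrArg QuaternionAlgebra.imI hw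
      have h3 := congrArg QuaternionAlgebra.imJ hw
      simp [w] at h1 h2 h3
      tauto
    have hmul : w * star w = 0 := by
      ext <;> simp [w]
      · linear_combination -hxyz
      all_goals ring
    have : star w = 0 := by
      simpa using (h w hw).mul_left_cancel (hmul.trans (mul_zero w).symm)
    exact hw (star_eq_zero.1 this)
  · intro h x hx
    refine isUnit_of_norm_ne_zero x fun hn => h ?_
    by_cases h1 : x.imJ ^ 2 - a * x.imK ^ 2 = 0
    · by_cases h2 : x.imK = 0
      · have h3 : x.imJ = 0 := by simpa [h2] using h1
        by_cases h4 : x.imI = 0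
        · refine absurd ?_ hx
          have h5 : x.re = 0 := by simpa [h2, h3, h4] using hn
          ext <;> simp [*]
        · refine Split.of_isSquare_left ⟨x.re / x.imI, ?_⟩
          field_simp
          rw [h2, h3] at hn
          linear_combination -hn
      · refine Split.of_isSquare_left ⟨x.imJ / x.imK, ?_⟩
        field_simp
        linear_combination -h1
    · refine ⟨x.re * x.imK + x.imI * x.imJ, x.imJ ^ 2 - a * x.imK ^ 2,
        x.re * x.imJ + a * x.imI * x.imK, Or.inr (Or.inl h1), ?_⟩
      linear_combination -(x.imJ ^ 2 - a * x.imK ^ 2) * hn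

namespace DefiniteQuaternion

variable {a b : ℚ}

lemma isRamified_iff (p : Nat.Primes) [Fact (p : ℕ).Prime] :
    IsRamified a b p ↔ ¬ Split (a : ℚ_[(p : ℕ)]) b :=
  QuaternionAlgebra.forall_isUnit_iff

lemma nrd_eq (x : QAlg a b) :
    nrd x = x.re ^ 2 - a * x.imI ^ 2 - b * x.imJ ^ 2 + a * b * x.imK ^ 2 := by
  simp [nrd]; ring

lemma nrd_mul (x y : QAlg a b) : nrd (x * y) = nrd x * nrd y := by
  simp only [nrd_eq, QuaternionAlgebra.re_mul, QuaternionAlgebra.imI_mul,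
    QuaternionAlgebra.imJ_mul, QuaternionAlgebra.imK_mul]
  ring

lemma nrd_add (x y : QAlg a b) : nrd (x + y) = nrd x + nrd y + 2 * (x * star y).re := by
  simp [nrd_eq]
  ring

@[simp] lemma nrd_star (x : QAlg a b) : nrd (star x) = nrd x := by
  simp [nrd_eq]

@[simp] lemma nrd_one : nrd (1 : QAlg a b) = 1 := by simp [nrd_eq]

@[simp] lemma nrd_zero : nrd (0 : QAlg a b) = 0 := by simp [nrd_eq]

lemma nrd_zsmul (m : ℤ) (x : QAlg a b) : nrd (m • x) = m ^ 2 * nrd x := by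
  simp [nrd_eq]; ring

lemma isUnit_of_ne_zero (ha : a < 0) (hb : b < 0) {x : QAlg a b} (hx : x ≠ 0) : IsUnit x := by
  refine QuaternionAlgebra.isUnit_of_norm_ne_zero x fun h => hx ?_
  have h1 : 0 ≤ -a * x.imI ^ 2 := mul_nonneg (by linarith) (sq_nonneg _)
  have h2 : 0 ≤ -b * x.imJ ^ 2 := mul_nonneg (by linarith) (sq_nonneg _)
  have hab := mul_pos_of_neg_of_neg ha hb
  have h3 : 0 ≤ a * b * x.imK ^ 2 := mul_nonneg hab.le (sq_nonneg _)
  have h0 := sq_nonneg x.re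
  have e0 : x.re ^ 2 = 0 := by linarith
  have e1 : -a * x.imI ^ 2 = 0 := by linarith
  have e2 : -b * x.imJ ^ 2 = 0 := by linarith
  have e3 : a * b * x.imK ^ 2 = 0 := by linarith
  ext
  · simpa using e0
  · simpa [ha.ne] using e1
  · simpa [hb.ne] using e2
  · simpa [ha.ne, hb.ne] using e3

/-- The `p`-adic absolute value of the reduced norm. -/
def pnorm (p : ℕ) [Fact p.Prime] (x : QAlg a b) : ℝ := ‖((nrd x : ℚ) : ℚ_[p])‖

section Ramified

variable {p : ℕ} [hp : Fact p.Prime]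

lemma pnorm_mul (x y : QAlg a b) : pnorm p (x * y) = pnorm p x * pnorm p y := by
  simp [pnorm, nrd_mul]

@[simp] lemma pnorm_zero : pnorm p (0 : QAlg a b) = 0 := by simp [pnorm]

@[simp] lemma pnorm_one : pnorm p (1 : QAlg a b) = 1 := by simp [pnorm]

lemma pnorm_nonneg (x : QAlg a b) : 0 ≤ pnorm p x := norm_nonneg _

lemma pnorm_star (x : QAlg a b) : pnorm p (star x) = pnorm p x := by simp [pnorm]

lemma pnorm_zsmul (m : ℤ) (x : QAlg a b) : pnorm p (m • x) = ‖(m : ℚ_[p])‖ ^ 2 * pnorm p x := by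
  rw [pnorm, nrd_zsmul, pnorm]
  push_cast
  rw [norm_mul, norm_pow]

lemma pnorm_zsmul_le (m : ℤ) (x : QAlg a b) : pnorm p (m • x) ≤ pnorm p x := by
  rw [pnorm_zsmul]
  have h1 : ‖(m : ℚ_[p])‖ ≤ 1 := Padic.norm_int_le_one m
  exact mul_le_of_le_one_left (pnorm_nonneg x) (pow_le_one₀ (norm_nonneg _) h1)

lemma pnorm_zsmul_of_not_dvd {m : ℤ} (hm : ¬ (p : ℤ) ∣ m) (x : QAlg a b) :
    pnorm p (m • x) = pnorm p x := by
  have h1 : ‖(m : ℚ_[p])‖ = 1 := le_antisymm (Padic.norm_int_le_one m)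
    (not_lt.1 fun h => hm ((Padic.norm_intCast_lt_one_iff).1 h))
  rw [pnorm_zsmul, h1, one_pow, one_mul]

/-- Substituting `r = t z` gives `z² - z + n / t²`, for which `1` is a simple root modulo `p`. -/
lemma exists_root_of_norm_lt {t n : ℚ_[p]} (h : ‖n‖ < ‖t‖ ^ 2) :
    ∃ r : ℚ_[p], r ^ 2 - t * r + n = 0 := by
  have ht : t ≠ 0 := by
    rintro rfl
    rw [norm_zero, zero_pow two_ne_zero] at h
    exact absurd h (not_lt.2 (norm_nonneg n))
  have ht' : 0 < ‖t‖ := norm_pos_iff.2 ht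
  have hc : ‖n / t ^ 2‖ < 1 := by
    rw [norm_div, norm_pow, div_lt_one (by positivity)]
    exact h
  let c : ℤ_[p] := ⟨n / t ^ 2, hc.le⟩
  let F : Polynomial ℤ_[p] := Polynomial.X ^ 2 - Polynomial.X + Polynomial.C c
  have hF : ‖F.aeval (1 : ℤ_[p])‖ < ‖F.derivative.aeval (1 : ℤ_[p])‖ ^ 2 := by
    have e1 : F.aeval (1 : ℤ_[p]) = c := by simp [F]
    have e2 : F.derivative.aeval (1 : ℤ_[p]) = 1 := by
      have : F.derivative = 2 * Polynomial.X - 1 := by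
        simp [F, one_add_one_eq_two]
        exact map_ofNat Polynomial.C 2
      rw [this]
      simp only [map_sub, map_mul, map_ofNat, Polynomial.aeval_X, map_one, mul_one]
      norm_num
    rw [e1, e2, norm_one, one_pow]
    exact hc
  obtain ⟨z, hz, -⟩ := hensels_lemma hF
  have hz' : z ^ 2 - z + c = 0 := by simpa [F] using hz
  have h3 := congrArg (fun x : ℤ_[p] => (x : ℚ_[p])) hz'
  push_cast at h3
  have hcc : (c : ℚ_[p]) = n / t ^ 2 := rfl
  rw [hcc] at h3
  refine ⟨t * z, ?_⟩
  field_simp at h3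
  linear_combination h3

/-- In a division quaternion algebra over `ℚ_p` the trace is bounded by the norm. -/
lemma norm_two_re_sq_le (h : ¬ Split (a : ℚ_[p]) b) (x : QAlg a b) :
    ‖((2 * x.re : ℚ) : ℚ_[p])‖ ^ 2 ≤ pnorm p x := by
  by_contra! hlt
  obtain ⟨r, hr⟩ := exists_root_of_norm_lt hlt
  rw [nrd_eq] at hr
  push_cast at hr
  let w : ℍ[ℚ_[p], (a : ℚ_[p]), (b : ℚ_[p])] := ⟨x.re - r, x.imI, x.imJ, x.imK⟩
  -- `w = x - r` has norm zero in a division algebra. So `x` is a scalar, for which the bound is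
  -- clear.
  have hw : w = 0 := by
    by_contra hw
    have hu := QuaternionAlgebra.forall_isUnit_iff.2 h w hw
    have hmul : w * star w = 0 := by
      ext <;> simp [w]
      · linear_combination hr
      all_goals ring
    have : star w = 0 := by
      simpa using hu.mul_left_cancel (hmul.trans (mul_zero w).symm)
    exact hw (star_eq_zero.1 this)
  have h1 : x.imI = 0 := by
    have := congrArg QuaternionAlgebra.imI hw
    simpa [w] using this
  have h2 : x.imJ = 0 := by
    have := congrArg QuaternionAlgebra.imJ hw
    simpa [w] using this
  have h3 : x.imK = 0 := by
    have := congrArg QuaternionAlgebra.imK hw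
    simpa [w] using this
  rw [pnorm, nrd_eq, h1, h2, h3] at hlt
  simp only [ne_eq, OfNat.ofNat_ne_zero, not_false_eq_true, zero_pow, mul_zero, sub_zero,
    add_zero, Rat.cast_mul, Rat.cast_pow, norm_mul, norm_pow, mul_pow] at hlt
  have h4 : ‖((2 : ℚ) : ℚ_[p])‖ ≤ 1 := by
    have := Padic.norm_int_le_one (p := p) 2
    simpa using this
  have h5 : ‖((2 : ℚ) : ℚ_[p])‖ ^ 2 ≤ 1 := pow_le_one₀ (norm_nonneg _) h4
  nlinarith [sq_nonneg ‖(x.re : ℚ_[p])‖]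

/-- The cross term of `nrd (x + y)` is the trace of `x * star y`, bounded by `norm_two_re_sq_le`. -/
lemma pnorm_add_le (h : ¬ Split (a : ℚ_[p]) b) {x y : QAlg a b} {r : ℝ}
    (hx : pnorm p x ≤ r) (hy : pnorm p y ≤ r) : pnorm p (x + y) ≤ r := by
  have h1 := norm_two_re_sq_le h (x * star y)
  rw [pnorm_mul, pnorm_star] at h1
  have h0 : 0 ≤ r := (pnorm_nonneg x).trans hx
  have h2 : ‖((2 * (x * star y).re : ℚ) : ℚ_[p])‖ ≤ r := by
    refine le_of_sq_le_sq ?_ h0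
    refine h1.trans ?_
    rw [sq]
    exact mul_le_mul hx hy (pnorm_nonneg y) h0
  rw [pnorm, nrd_add, Rat.cast_add, Rat.cast_add]
  refine (Padic.nonarchimedean _ _).trans (max_le ?_ h2)
  exact (Padic.nonarchimedean _ _).trans (max_le hx hy)

/-- The elements of bounded reduced norm form a lattice at a ramified prime. -/
def pball (p : ℕ) [Fact p.Prime] (h : ¬ Split (a : ℚ_[p]) b) {r : ℝ} (hr : 0 ≤ r) :
    Submodule ℤ (QAlg a b) where
  carrier := {x | pnorm p x ≤ r}
  zero_mem' := by simpa using hr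
  add_mem' := pnorm_add_le h
  smul_mem' m x hx := (pnorm_zsmul_le m x).trans hx

end Ramified

end DefiniteQuaternion

end

/-! ### Lattices and maximal orders at a ramified prime -/

noncomputable section

section Lattice

variable {M : Type*} [AddCommGroup M]

/-- The integers `m` with `m • x ∈ L` form an ideal contained in no `(p)`, hence all of `ℤ`. -/
lemma Submodule.mem_of_forall_prime (L : Submodule ℤ M) {x : M}
    (h : ∀ p : ℕ, p.Prime → ∃ m : ℤ, ¬ (p : ℤ) ∣ m ∧ m • x ∈ L) : x ∈ L := by
  let I : Ideal ℤ := L.comap (LinearMap.toSpanSingleton ℤ M x)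
  have hI : ∀ m : ℤ, m ∈ I ↔ m • x ∈ L := fun m => by simp [I]
  obtain ⟨d, hd⟩ := (IsPrincipalIdealRing.principal I).principal
  by_cases h1 : d.natAbs = 1
  · have : (1 : ℤ) ∈ I := by
      rw [hd]
      exact Ideal.mem_span_singleton.2 (Int.isUnit_iff_natAbs_eq.2 h1).dvd
    simpa using (hI 1).1 this
  · obtain ⟨p, hp, hpd⟩ := Nat.exists_prime_and_dvd h1
    obtain ⟨m, hm, hmx⟩ := h p hp
    rw [← hI, hd] at hmx
    exact absurd ((Int.natCast_dvd.2 hpd).trans (Ideal.mem_span_singleton.1 hmx)) hm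

lemma Submodule.FG.exists_zsmul_mem {L L' : Submodule ℤ M} (hL : L.FG)
    (h : ∀ x ∈ L, ∃ n : ℤ, n ≠ 0 ∧ n • x ∈ L') : ∃ n : ℤ, n ≠ 0 ∧ ∀ x ∈ L, n • x ∈ L' := by
  classical
  obtain ⟨S, rfl⟩ := hL
  have key : ∀ T : Finset M, T ⊆ S → ∃ n : ℤ, n ≠ 0 ∧ ∀ x ∈ T, n • x ∈ L' := by
    intro T
    induction T using Finset.induction_on with
    | empty => exact fun _ => ⟨1, one_ne_zero, by simp⟩
    | insert s T hs ih =>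
      intro hT
      obtain ⟨n, hn, hnT⟩ := ih ((Finset.subset_insert s T).trans hT)
      obtain ⟨m, hm, hms⟩ := h s (Submodule.subset_span (hT (Finset.mem_insert_self s T)))
      refine ⟨n * m, mul_ne_zero hn hm, fun x hx => ?_⟩
      rcases Finset.mem_insert.1 hx with rfl | hx
      · rw [mul_smul]
        exact L'.smul_mem n hms
      · rw [mul_comm, mul_smul]
        exact L'.smul_mem m (hnT x hx)
  obtain ⟨n, hn, hS⟩ := key S subset_rfl
  refine ⟨n, hn, fun x hx => ?_⟩
  have : Submodule.span ℤ (S : Set M) ≤ L'.comap (LinearMap.lsmul ℤ M n) :=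
    Submodule.span_le.2 fun s hs => hS s hs
  exact this hx

end Lattice

namespace DefiniteQuaternion

variable {a b : ℚ}

lemma IsFullLattice.exists_zsmul_mem {L : Submodule ℤ (QAlg a b)} (hL : IsFullLattice L)
    (x : QAlg a b) : ∃ n : ℤ, n ≠ 0 ∧ n • x ∈ L := by
  have hx : x ∈ Submodule.span ℚ (L : Set (QAlg a b)) := by rw [hL.2]; trivial
  induction hx using Submodule.span_induction with
  | mem x hx => exact ⟨1, one_ne_zero, by simpa using hx⟩
  | zero => exact ⟨1, one_ne_zero, by simp⟩
  | add x y _ _ hx hy =>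
    obtain ⟨n, hn, hnx⟩ := hx
    obtain ⟨m, hm, hmy⟩ := hy
    refine ⟨n * m, mul_ne_zero hn hm, ?_⟩
    rw [smul_add]
    refine L.add_mem ?_ ?_
    · rw [mul_comm, mul_smul]
      exact L.smul_mem m hnx
    · rw [mul_smul]
      exact L.smul_mem n hmy
  | smul q x _ hx =>
    obtain ⟨n, hn, hnx⟩ := hx
    refine ⟨n * q.den, mul_ne_zero hn (by exact_mod_cast q.den_ne_zero), ?_⟩
    have : (n * q.den : ℤ) • q • x = q.num • n • x := by
      rw [← Int.cast_smul_eq_zsmul ℚ, ← Int.cast_smul_eq_zsmul ℚ q.num,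
        ← Int.cast_smul_eq_zsmul ℚ n, smul_smul, smul_smul]
      congr 1
      push_cast
      rw [mul_assoc, mul_comm (q.den : ℚ), Rat.mul_den_eq_num, mul_comm]
    rw [this]
    exact L.smul_mem _ hnx

/-- The quaternions with integral coordinates. -/
def intLattice (a b : ℚ) : Submodule ℤ (QAlg a b) where
  carrier := {x | ∃ r s t v : ℤ, x = ⟨r, s, t, v⟩}
  zero_mem' := ⟨0, 0, 0, 0, by ext <;> simp⟩
  add_mem' := by
    rintro _ _ ⟨r, s, t, v, rfl⟩ ⟨r', s', t', v', rfl⟩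
    exact ⟨r + r', s + s', t + t', v + v', by ext <;> simp⟩
  smul_mem' := by
    rintro m _ ⟨r, s, t, v, rfl⟩
    exact ⟨m * r, m * s, m * t, m * v, by ext <;> simp⟩

lemma intLattice_fg : (intLattice a b).FG := by
  classical
  refine ⟨{⟨1, 0, 0, 0⟩, ⟨0, 1, 0, 0⟩, ⟨0, 0, 1, 0⟩, ⟨0, 0, 0, 1⟩}, le_antisymm ?_ ?_⟩
  · rw [Submodule.span_le]
    intro x hx
    simp only [Finset.coe_insert, Finset.coe_singleton, Set.mem_insert_iff,
      Set.mem_singleton_iff] at hx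
    rcases hx with rfl | rfl | rfl | rfl
    · exact ⟨1, 0, 0, 0, by simp⟩
    · exact ⟨0, 1, 0, 0, by simp⟩
    · exact ⟨0, 0, 1, 0, by simp⟩
    · exact ⟨0, 0, 0, 1, by simp⟩
  · rintro _ ⟨r, s, t, v, rfl⟩
    have : (⟨r, s, t, v⟩ : QAlg a b) = r • ⟨1, 0, 0, 0⟩ + s • ⟨0, 1, 0, 0⟩ + t • ⟨0, 0, 1, 0⟩ +
        v • ⟨0, 0, 0, 1⟩ := by
      ext <;> simp
    rw [this]
    refine add_mem (add_mem (add_mem ?_ ?_) ?_) ?_ <;>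
    exact Submodule.smul_mem _ _ (Submodule.subset_span (by simp))

lemma zsmul_eq_mk (m : ℤ) (x : QAlg a b) :
    m • x = ⟨m * x.re, m * x.imI, m * x.imJ, m * x.imK⟩ := by
  ext <;> simp

lemma zsmul_injective {m : ℤ} (hm : m ≠ 0) : Function.Injective fun x : QAlg a b => m • x := by
  intro x y hxy
  have hm' : (m : ℚ) ≠ 0 := by exact_mod_cast hm
  simpa [zsmul_eq_mk, QuaternionAlgebra.ext_iff, hm'] using hxy

lemma exists_zsmul_mem_intLattice (x : QAlg a b) : ∃ n : ℤ, n ≠ 0 ∧ n • x ∈ intLattice a b := by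
  refine ⟨x.re.den * x.imI.den * x.imJ.den * x.imK.den, ?_,
    x.re.num * x.imI.den * x.imJ.den * x.imK.den, x.re.den * x.imI.num * x.imJ.den * x.imK.den,
    x.re.den * x.imI.den * x.imJ.num * x.imK.den, x.re.den * x.imI.den * x.imJ.den * x.imK.num, ?_⟩
  · have := x.re.den_ne_zero
    have := x.imI.den_ne_zero
    have := x.imJ.den_ne_zero
    have := x.imK.den_ne_zero
    positivity
  · have h1 := Rat.mul_den_eq_num x.re
    have h2 := Rat.mul_den_eq_num x.imI
    have h3 := Rat.mul_den_eq_num x.imJ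
    have h4 := Rat.mul_den_eq_num x.imK
    rw [zsmul_eq_mk]
    push_cast
    rw [← h1, ← h2, ← h3, ← h4]
    congr 1 <;> ring

section Ramified

variable {p : ℕ} [hp : Fact p.Prime]

lemma exists_int_eq_of_norm_le_one {c : ℚ} {k : ℕ} {n : ℤ} (h : (p : ℚ) ^ k * c = n)
    (hc : ‖(c : ℚ_[p])‖ ≤ 1) : ∃ m : ℤ, c = m := by
  have hp0 : (p : ℚ) ^ k ≠ 0 := pow_ne_zero _ (by exact_mod_cast hp.out.ne_zero)
  have h1 : ‖(n : ℚ_[p])‖ ≤ (p : ℝ) ^ (-k : ℤ) := by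
    have h2 := congrArg (Rat.cast : ℚ → ℚ_[p]) h
    push_cast at h2
    rw [← h2, norm_mul, norm_pow, Padic.norm_p, zpow_neg, zpow_natCast, inv_pow]
    exact mul_le_of_le_one_right (by positivity) hc
  rw [Padic.norm_int_le_pow_iff_dvd] at h1
  obtain ⟨m, rfl⟩ := h1
  refine ⟨m, mul_left_cancel₀ hp0 (h.trans ?_)⟩
  push_cast
  rfl

lemma exists_norm_le_of_two_re_eq (h : ¬ Split (a : ℚ_[p]) b) (e : QAlg a b) {d : ℚ} (hd : d ≠ 0) :
    ∃ R : ℝ, ∀ (y : QAlg a b) (c : ℚ), pnorm p y ≤ 1 → 2 * (y * e).re = d * c →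
      ‖(c : ℚ_[p])‖ ≤ R := by
  have hd' : 0 < ‖(d : ℚ_[p])‖ := norm_pos_iff.2 (by exact_mod_cast hd)
  refine ⟨√(pnorm p e) / ‖(d : ℚ_[p])‖, fun y c hy hc => ?_⟩
  have h1 := norm_two_re_sq_le h (y * e)
  rw [hc, pnorm_mul, Rat.cast_mul, norm_mul] at h1
  rw [le_div_iff₀ hd', mul_comm]
  exact Real.le_sqrt_of_sq_le (h1.trans (mul_le_of_le_one_left (pnorm_nonneg e) hy))

/-- Up to constants the coordinates are the traces of `y` times `1`, `i`, `j`, `k`, and the norm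
bounds traces. -/
lemma exists_coord_norm_le (h : ¬ Split (a : ℚ_[p]) b) (ha : a ≠ 0) (hb : b ≠ 0) :
    ∃ R : ℝ, ∀ y : QAlg a b, pnorm p y ≤ 1 → ‖(y.re : ℚ_[p])‖ ≤ R ∧ ‖(y.imI : ℚ_[p])‖ ≤ R ∧
      ‖(y.imJ : ℚ_[p])‖ ≤ R ∧ ‖(y.imK : ℚ_[p])‖ ≤ R := by
  obtain ⟨R₀, h₀⟩ := exists_norm_le_of_two_re_eq h 1 (d := 2) (by norm_num)
  obtain ⟨R₁, h₁⟩ := exists_norm_le_of_two_re_eq h ⟨0, 1, 0, 0⟩ (d := 2 * a) (by simpa)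
  obtain ⟨R₂, h₂⟩ := exists_norm_le_of_two_re_eq h ⟨0, 0, 1, 0⟩ (d := 2 * b) (by simpa)
  obtain ⟨R₃, h₃⟩ := exists_norm_le_of_two_re_eq h ⟨0, 0, 0, 1⟩ (d := 2 * -(a * b))
    (by simp [ha, hb])
  refine ⟨max (max R₀ R₁) (max R₂ R₃), fun y hy => ⟨?_, ?_, ?_, ?_⟩⟩
  · exact (h₀ y _ hy (by simp)).trans (by simp)
  · exact (h₁ y _ hy (by simp; ring)).trans (by simp)
  · exact (h₂ y _ hy (by simp; ring)).trans (by simp)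
  · exact (h₃ y _ hy (by simp; ring)).trans (by simp)

lemma exists_pnorm_max (h : ¬ Split (a : ℚ_[p]) b) {L : Submodule ℤ (QAlg a b)} (hL : L.FG) :
    ∃ x ∈ L, ∀ y ∈ L, pnorm p y ≤ pnorm p x := by
  obtain ⟨S, rfl⟩ := hL
  rcases S.eq_empty_or_nonempty with rfl | hS
  · exact ⟨0, zero_mem _, by simp⟩
  · obtain ⟨x, hx, hmax⟩ := S.exists_max_image (pnorm p) hS
    refine ⟨x, Submodule.subset_span hx, fun y hy => ?_⟩
    have : Submodule.span ℤ (S : Set (QAlg a b)) ≤ pball p h (pnorm_nonneg (p := p) x) :=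
      Submodule.span_le.2 hmax
    exact this hy

variable {O : Subalgebra ℤ (QAlg a b)}

lemma pnorm_pow (x : QAlg a b) (n : ℕ) : pnorm p (x ^ n) = pnorm p x ^ n := by
  induction n with
  | zero => simp
  | succ n ih => rw [pow_succ, pnorm_mul, ih, pow_succ]

/-- All powers of `x` lie in the lattice `O`, on which `pnorm` is bounded. -/
lemma IsOrder.pnorm_le_one (hO : IsOrder O) (h : ¬ Split (a : ℚ_[p]) b) {x : QAlg a b}
    (hx : x ∈ O) : pnorm p x ≤ 1 := by
  obtain ⟨y, -, hy⟩ := exists_pnorm_max h hO.1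
  by_contra! h1
  obtain ⟨n, hn⟩ := pow_unbounded_of_one_lt (pnorm p y) h1
  rw [← pnorm_pow] at hn
  exact absurd hn (not_lt.2 (hy _ (O.pow_mem hx n)))

/-- The elements of `O[1/p]` of `p`-integral reduced norm. -/
def normIntegralClosure (p : ℕ) [hp : Fact p.Prime] (h : ¬ Split (a : ℚ_[p]) b) (hO : IsOrder O) :
    Subalgebra ℤ (QAlg a b) where
  carrier := {y | pnorm p y ≤ 1 ∧ ∃ k : ℕ, ((p : ℤ) ^ k) • y ∈ O}
  mul_mem' := by
    rintro x y ⟨hx, k, hkx⟩ ⟨hy, l, hly⟩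
    refine ⟨by rw [pnorm_mul]; exact mul_le_one₀ hx (pnorm_nonneg y) hy, k + l, ?_⟩
    rw [pow_add, ← smul_mul_smul_comm]
    exact O.mul_mem hkx hly
  add_mem' := by
    rintro x y ⟨hx, k, hkx⟩ ⟨hy, l, hly⟩
    refine ⟨pnorm_add_le h hx hy, k + l, ?_⟩
    rw [smul_add]
    refine O.add_mem ?_ ?_
    · rw [pow_add, mul_comm, mul_smul]
      exact O.smul_mem hkx _
    · rw [pow_add, mul_smul]
      exact O.smul_mem hly _
  algebraMap_mem' r := ⟨hO.pnorm_le_one h (O.algebraMap_mem r), 0,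
    by simp⟩

lemma le_normIntegralClosure (h : ¬ Split (a : ℚ_[p]) b) (hO : IsOrder O) :
    O ≤ normIntegralClosure p h hO :=
  fun x hx => ⟨hO.pnorm_le_one h hx, 0, by simpa using hx⟩

/-- Denominators are bounded: away from `p` they come from `O` and are cleared by `D`; at `p` the
coordinate bound lets `p ^ K` clear them. -/
lemma isOrder_normIntegralClosure (ha : a ≠ 0) (hb : b ≠ 0) (h : ¬ Split (a : ℚ_[p]) b)
    (hO : IsOrder O) : IsOrder (normIntegralClosure p h hO) := by
  refine ⟨?_, ?_⟩
  swap
  · rw [eq_top_iff, ← hO.2]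
    exact Submodule.span_mono (le_normIntegralClosure h hO)
  obtain ⟨D, hD, hDO⟩ := Submodule.FG.exists_zsmul_mem hO.1
    (L' := intLattice a b) fun x _ => exists_zsmul_mem_intLattice x
  obtain ⟨R, hR⟩ := exists_coord_norm_le h ha hb
  obtain ⟨K, hK⟩ := pow_unbounded_of_one_lt R
    (show (1 : ℝ) < p by exact_mod_cast hp.out.one_lt)
  have hE : ((p : ℤ) ^ K * D) ≠ 0 :=
    mul_ne_zero (pow_ne_zero _ (by exact_mod_cast hp.out.ne_zero)) hD
  have hcoord : ∀ (c : ℚ) (k : ℕ) (n : ℤ), ‖(c : ℚ_[p])‖ ≤ R → (D : ℚ) * ((p : ℚ) ^ k * c) = n →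
      ∃ m : ℤ, (p : ℚ) ^ K * D * c = m := by
    intro c k n hc hn
    refine exists_int_eq_of_norm_le_one (p := p) (k := k) (n := p ^ K * n) ?_ ?_
    · push_cast
      rw [← hn]; ring
    · push_cast
      rw [norm_mul, norm_mul, norm_pow, Padic.norm_p, inv_pow]
      have h1 : ‖(D : ℚ_[p])‖ ≤ 1 := Padic.norm_int_le_one D
      have h2 : (0 : ℝ) < (p : ℝ) ^ K := pow_pos (by exact_mod_cast hp.out.pos) K
      rw [mul_assoc, inv_mul_le_iff₀ h2, mul_one]
      exact (mul_le_of_le_one_left (norm_nonneg _) h1).trans (hc.trans hK.le)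
  refine Submodule.fg_of_fg_map_injective (LinearMap.lsmul ℤ (QAlg a b) ((p : ℤ) ^ K * D))
    (zsmul_injective hE) (intLattice_fg.of_le ?_)
  rintro _ ⟨y, ⟨hy, k, hky⟩, rfl⟩
  obtain ⟨r, s, t, v, hrstv⟩ := hDO _ hky
  rw [zsmul_eq_mk, zsmul_eq_mk, QuaternionAlgebra.mk.injEq] at hrstv
  push_cast at hrstv
  obtain ⟨h₀, h₁, h₂, h₃⟩ := hR y hy
  obtain ⟨r', hr⟩ := hcoord y.re k r h₀ hrstv.1
  obtain ⟨s', hs⟩ := hcoord y.imI k s h₁ hrstv.2.1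
  obtain ⟨t', ht⟩ := hcoord y.imJ k t h₂ hrstv.2.2.1
  obtain ⟨v', hv⟩ := hcoord y.imK k v h₃ hrstv.2.2.2
  refine ⟨r', s', t', v', ?_⟩
  rw [LinearMap.lsmul_apply, zsmul_eq_mk, ← hr, ← hs, ← ht, ← hv]
  push_cast
  rfl

/-- At a ramified prime, a maximal order consists of all elements of integral reduced norm. -/
lemma IsMaximalOrder.exists_zsmul_mem (ha : a ≠ 0) (hb : b ≠ 0) (hO : IsMaximalOrder O)
    (h : ¬ Split (a : ℚ_[p]) b) {x : QAlg a b} (hx : pnorm p x ≤ 1) :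
    ∃ m : ℤ, ¬ (p : ℤ) ∣ m ∧ m • x ∈ O := by
  obtain ⟨n, hn, hnx⟩ := hO.1.exists_zsmul_mem x
  have hfin : FiniteMultiplicity (p : ℤ) n :=
    Int.finiteMultiplicity_iff.2 ⟨by simp [hp.out.ne_one], hn⟩
  obtain ⟨m, hm, hpm⟩ := hfin.exists_eq_pow_mul_and_not_dvd
  refine ⟨m, hpm, ?_⟩
  rw [← hO.2 _ (isOrder_normIntegralClosure ha hb h hO.1) (le_normIntegralClosure h hO.1)]
  refine ⟨(pnorm_zsmul_le m x).trans hx, multiplicity (p : ℤ) n, ?_⟩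
  rw [smul_smul, ← hm]
  exact hnx

end Ramified

end DefiniteQuaternion

end

/-! ### Right ideals as balls and the fixed class -/

noncomputable section

namespace DefiniteQuaternion

variable {a b : ℚ} {O : Subalgebra ℤ (QAlg a b)}

section Ramified

variable {p : ℕ} [hp : Fact p.Prime]

/-- `r` is the largest `p`-adic absolute value of a reduced norm on the nonzero lattice `L`. -/
def IsMaxPnorm (p : ℕ) [Fact p.Prime] (L : Submodule ℤ (QAlg a b)) (r : ℝ) : Prop :=
  0 < r ∧ (∃ x ∈ L, pnorm p x = r) ∧ ∀ x ∈ L, pnorm p x ≤ r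

lemma pnorm_pos (ha : a < 0) (hb : b < 0) {x : QAlg a b} (hx : x ≠ 0) : 0 < pnorm p x := by
  obtain ⟨u, rfl⟩ := isUnit_of_ne_zero ha hb hx
  have h : pnorm p (u : QAlg a b) * pnorm p (↑u⁻¹ : QAlg a b) = 1 := by
    rw [← pnorm_mul, Units.mul_inv, pnorm_one]
  exact (pnorm_nonneg _).lt_of_ne fun h0 => by simp [← h0] at h

lemma RightIdeal.exists_isMaxPnorm (ha : a < 0) (hb : b < 0) (h : ¬ Split (a : ℚ_[p]) b)
    (I : RightIdeal O) : ∃ r, IsMaxPnorm p I.lattice r := by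
  obtain ⟨x, hx, hmax⟩ := exists_pnorm_max h I.full.1
  refine ⟨pnorm p x, ?_, ⟨x, hx, rfl⟩, hmax⟩
  obtain ⟨n, hn, hn1⟩ := I.full.exists_zsmul_mem 1
  refine (pnorm_pos ha hb ?_).trans_le (hmax _ hn1)
  intro h0
  exact one_ne_zero (zsmul_injective hn (h0.trans (smul_zero n).symm))

/-- At a ramified prime a right ideal is a ball. -/
lemma RightIdeal.exists_zsmul_mem (ha : a < 0) (hb : b < 0) (hO : IsMaximalOrder O)
    (h : ¬ Split (a : ℚ_[p]) b) {I : RightIdeal O} {r : ℝ} (hI : IsMaxPnorm p I.lattice r)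
    {x : QAlg a b} (hx : pnorm p x ≤ r) : ∃ m : ℤ, ¬ (p : ℤ) ∣ m ∧ m • x ∈ I.lattice := by
  obtain ⟨hr, ⟨y, hy, rfl⟩, -⟩ := hI
  have hy0 : y ≠ 0 := by
    rintro rfl
    simp at hr
  obtain ⟨u, rfl⟩ := isUnit_of_ne_zero ha hb hy0
  -- An element of maximal norm generates the ideal locally: write `x = u (u⁻¹ x)`.
  have h1 : pnorm p ((↑u⁻¹ : QAlg a b) * x) ≤ 1 := by
    refine le_of_mul_le_mul_left ?_ hr
    rwa [← pnorm_mul, Units.mul_inv_cancel_left, mul_one]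
  obtain ⟨m, hm, hmx⟩ := hO.exists_zsmul_mem ha.ne hb.ne h h1
  refine ⟨m, hm, ?_⟩
  have := I.mul_mem _ hy _ hmx
  rwa [mul_smul_comm, Units.mul_inv_cancel_left] at this

lemma pnorm_le_of_mem_primeIdeal (hO : IsOrder O) (h : ¬ Split (a : ℚ_[p]) b) {x : QAlg a b}
    (hx : x ∈ primeIdeal O ⟨p, hp.out⟩) : pnorm p x ≤ (p : ℝ)⁻¹ := by
  have h0 : (0 : ℝ) ≤ (p : ℝ)⁻¹ := by positivity
  have hle : primeIdeal O ⟨p, hp.out⟩ ≤ pball p h h0 := by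
    have h1 : Submodule.span ℤ {x : QAlg a b | x ∈ O ∧ ∃ k : ℤ, nrd x = (p : ℕ) * k} ≤
        pball p h h0 := by
      rw [Submodule.span_le]
      rintro x ⟨-, k, hk⟩
      change pnorm p x ≤ (p : ℝ)⁻¹
      rw [pnorm, hk]
      push_cast
      rw [norm_mul, Padic.norm_p]
      exact mul_le_of_le_one_right h0 (Padic.norm_int_le_one k)
    refine Submodule.mul_le.2 fun x hx y hy => ?_
    change pnorm p (x * y) ≤ (p : ℝ)⁻¹
    rw [pnorm_mul]
    refine (mul_le_of_le_one_right (pnorm_nonneg x) (hO.pnorm_le_one h hy)).trans ?_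
    have : Subalgebra.toSubmodule O *
        Submodule.span ℤ {x : QAlg a b | x ∈ O ∧ ∃ k : ℤ, nrd x = (p : ℕ) * k} ≤
        pball p h h0 := by
      refine Submodule.mul_le.2 fun x hx y hy => ?_
      change pnorm p (x * y) ≤ (p : ℝ)⁻¹
      rw [pnorm_mul]
      exact (mul_le_of_le_one_left (pnorm_nonneg y) (hO.pnorm_le_one h hx)).trans (h1 hy)
    exact this hx
  exact hle hx

/-- Since `p` divides `nrd u` exactly once, `u` is a uniformizer at `p`; a multiple prime to `p`
lies in `O`, hence in `𝔓_p`. One global `u` serves all `p ∣ N`. -/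
lemma IsMaxPnorm.mul_primeIdeal (ha : a < 0) (hb : b < 0) (hO : IsMaximalOrder O)
    (h : ¬ Split (a : ℚ_[p]) b) {u : QAlg a b} {N : ℕ} (hu : nrd u = N) (hpN : p ∣ N)
    (hpN2 : ¬ p ^ 2 ∣ N) {L : Submodule ℤ (QAlg a b)} {r : ℝ} (hL : IsMaxPnorm p L r) :
    IsMaxPnorm p (L * primeIdeal O ⟨p, hp.out⟩) (r * (p : ℝ)⁻¹) := by
  have hp0 : (0 : ℝ) < (p : ℝ)⁻¹ := inv_pos.2 (by exact_mod_cast hp.out.pos)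
  obtain ⟨hr, ⟨x, hx, hxr⟩, hmax⟩ := hL
  refine ⟨mul_pos hr hp0, ?_, fun y hy => ?_⟩
  · obtain ⟨k, rfl⟩ := hpN
    have hk : ¬ p ∣ k := fun hk => hpN2 (by rw [sq]; exact mul_dvd_mul_left p hk)
    have hk1 : ‖(k : ℚ_[p])‖ = 1 := le_antisymm
      (by simpa using Padic.norm_int_le_one (p := p) (k : ℤ))
      (not_lt.1 fun h => hk (Padic.norm_natCast_lt_one_iff.1 h))
    have hun : pnorm p u = (p : ℝ)⁻¹ := by
      rw [pnorm, hu]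
      push_cast
      rw [norm_mul, Padic.norm_p, hk1, mul_one]
    have hp1 : (p : ℝ)⁻¹ ≤ 1 := inv_le_one_of_one_le₀ (by exact_mod_cast hp.out.one_le)
    obtain ⟨m, hm, hmu⟩ := hO.exists_zsmul_mem ha.ne hb.ne h (hun.trans_le hp1)
    refine ⟨x * m • u, Submodule.mul_mem_mul hx ?_, ?_⟩
    · have h1 : m • u ∈ Submodule.span ℤ {x : QAlg a b | x ∈ O ∧ ∃ k : ℤ, nrd x = (p : ℕ) * k} := by
        refine Submodule.subset_span ⟨hmu, m ^ 2 * k, ?_⟩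
        rw [nrd_zsmul, hu]
        push_cast
        ring
      have h2 : (1 : QAlg a b) ∈ Subalgebra.toSubmodule O := O.one_mem
      have h3 := Submodule.mul_mem_mul (Submodule.mul_mem_mul h2 h1) h2
      rwa [one_mul, mul_one] at h3
    · rw [pnorm_mul, pnorm_zsmul_of_not_dvd hm, hun, hxr]
  · have hle : L * primeIdeal O ⟨p, hp.out⟩ ≤ pball p h (mul_pos hr hp0).le := by
      refine Submodule.mul_le.2 fun x hx y hy => ?_
      change pnorm p (x * y) ≤ r * (p : ℝ)⁻¹
      rw [pnorm_mul]
      exact mul_le_mul (hmax x hx) (pnorm_le_of_mem_primeIdeal hO.1 h hy) (pnorm_nonneg y) hr.le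
    exact hle hy

lemma IsMaxPnorm.of_le_of_zsmul_mem {L L' : Submodule ℤ (QAlg a b)} {r : ℝ}
    (hL : IsMaxPnorm p L r) (hle : L' ≤ L) {m : ℤ} (hm : ¬ (p : ℤ) ∣ m)
    (hmem : ∀ x ∈ L, m • x ∈ L') : IsMaxPnorm p L' r := by
  obtain ⟨hr, ⟨x, hx, hxr⟩, hmax⟩ := hL
  exact ⟨hr, ⟨m • x, hmem x hx, by rw [pnorm_zsmul_of_not_dvd hm, hxr]⟩, fun y hy => hmax y (hle hy)⟩

lemma IsMaxPnorm.translate {I : RightIdeal O} {r : ℝ} (hI : IsMaxPnorm p I.lattice r)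
    (u : (QAlg a b)ˣ) (hu : 0 < pnorm p (u : QAlg a b)) :
    IsMaxPnorm p (I.translate u).lattice (r * pnorm p (u : QAlg a b)) := by
  obtain ⟨hr, ⟨x, hx, hxr⟩, hmax⟩ := hI
  refine ⟨mul_pos hr hu, ⟨u * x, ⟨x, hx, rfl⟩, ?_⟩, ?_⟩
  · rw [pnorm_mul, hxr, mul_comm]
  · rintro _ ⟨y, hy, rfl⟩
    rw [LinearMap.mulLeft_apply, pnorm_mul, mul_comm]
    exact mul_le_mul_of_nonneg_right (hmax y hy) hu.le

end Ramified

/-- Comparison of right ideals which agree away from the discriminant. -/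
lemma RightIdeal.le_of_isMaxPnorm (ha : a < 0) (hb : b < 0) (hO : IsMaximalOrder O) {N : ℕ}
    (hN : ∀ (p : ℕ) [Fact p.Prime], p ∣ N → ¬ Split (a : ℚ_[p]) b) {I J : RightIdeal O}
    (hmem : ∀ x ∈ I.lattice, (N : ℤ) • x ∈ J.lattice)
    (hmax : ∀ (p : ℕ) [Fact p.Prime], p ∣ N →
      ∃ r, IsMaxPnorm p I.lattice r ∧ IsMaxPnorm p J.lattice r) :
    I.lattice ≤ J.lattice := by
  intro x hx
  refine Submodule.mem_of_forall_prime _ fun p hp => ?_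
  have := Fact.mk hp
  by_cases hpN : p ∣ N
  · obtain ⟨r, hI, hJ⟩ := hmax p hpN
    exact RightIdeal.exists_zsmul_mem ha hb hO (hN p hpN) hJ (hI.2.2 x hx)
  · exact ⟨N, by rwa [Int.natCast_dvd_natCast], hmem x hx⟩

/-- The composition of the `σ_p` over a list of primes. -/
def sigmaList (hO : IsOrder O) (l : List Nat.Primes) : Cl O → Cl O :=
  (l.map (sigma hO)).foldr (· ∘ ·) id

@[simp] lemma sigmaList_nil (hO : IsOrder O) (x : Cl O) : sigmaList hO [] x = x := rfl

@[simp] lemma sigmaList_cons (hO : IsOrder O) (p : Nat.Primes) (l : List Nat.Primes) (x : Cl O) :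
    sigmaList hO (p :: l) x = sigma hO p (sigmaList hO l x) := rfl

/-- The primes dividing `N`, with multiplicity. -/
def primesList (N : ℕ) : List Nat.Primes :=
  N.primeFactorsList.pmap (fun p hp => (⟨p, hp⟩ : Nat.Primes)) fun _ hp => Nat.prime_of_mem_primeFactorsList hp

lemma map_val_primesList (N : ℕ) : (primesList N).map (fun p : Nat.Primes => (p : ℕ)) = N.primeFactorsList := by
  refine (List.map_pmap (p := Nat.Prime) (g := fun p : Nat.Primes => (p : ℕ))
    (f := fun p hp => (⟨p, hp⟩ : Nat.Primes)) _).trans ?_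
  exact (List.pmap_eq_map (f := id) _).trans (List.map_id _)

lemma mem_primesList {N : ℕ} (hN : N ≠ 0) (p : Nat.Primes) : p ∈ primesList N ↔ (p : ℕ) ∣ N := by
  have h := Nat.mem_primeFactorsList (p := p) hN
  rw [← map_val_primesList, List.mem_map] at h
  constructor
  · exact fun hp => (h.1 ⟨p, hp, rfl⟩).2
  · intro hp
    obtain ⟨q, hq, hqp⟩ := h.2 ⟨p.2, hp⟩
    rwa [← Subtype.ext hqp]

lemma sigmaProd_eq_sigmaList (hO : IsOrder O) (N : ℕ) :
    sigmaProd hO N = sigmaList hO (primesList N) := by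
  exact congrArg (List.foldr (· ∘ ·) id) (List.map_pmap (p := Nat.Prime) (g := sigma hO)
    (f := fun p hp => (⟨p, hp⟩ : Nat.Primes)) _).symm

/-- A representative of `σ_{p₁} ⋯ σ_{pₖ} [I]` with its local behaviour. -/
lemma RightIdeal.exists_cls_eq_sigmaList (ha : a < 0) (hb : b < 0) (hO : IsMaximalOrder O)
    {u : QAlg a b} {N : ℕ} (hu : nrd u = N) (hNsq : Squarefree N)
    (hN : ∀ (p : ℕ) [Fact p.Prime], p ∣ N → ¬ Split (a : ℚ_[p]) b) (I : RightIdeal O)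
    (l : List Nat.Primes) (hl : l.Nodup) (hlN : ∀ p ∈ l, (p : ℕ) ∣ N) :
    ∃ J : RightIdeal O, sigmaList hO.1 l I.cls = J.cls ∧ J.lattice ≤ I.lattice ∧
      (∀ x ∈ I.lattice, ((l.map fun p : Nat.Primes => (p : ℕ)).prod : ℤ) • x ∈ J.lattice) ∧
      ∀ (p : ℕ) [hp : Fact p.Prime] (r : ℝ), p ∣ N → IsMaxPnorm p I.lattice r →
        ((⟨p, hp.out⟩ : Nat.Primes) ∈ l → IsMaxPnorm p J.lattice (r * (p : ℝ)⁻¹)) ∧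
        ((⟨p, hp.out⟩ : Nat.Primes) ∉ l → IsMaxPnorm p J.lattice r) := by
  induction l with
  | nil => exact ⟨I, rfl, le_rfl, by simp, fun p _ r _ h =>
      ⟨fun h' => absurd h' List.not_mem_nil, fun _ => h⟩⟩
  | cons q l ih =>
    rw [List.nodup_cons] at hl
    obtain ⟨J, hJ, hle, hmem, hmax⟩ := ih hl.2 fun p hp => hlN p (List.mem_cons_of_mem _ hp)
    have hle' : (J.mulPrime hO.1 q).lattice ≤ J.lattice := by
      refine Submodule.mul_le.2 fun x hx y hy => J.mul_mem x hx y ?_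
      exact primeIdeal_le O q hy
    have hmem' : ∀ x ∈ J.lattice, ((q : ℕ) : ℤ) • x ∈ (J.mulPrime hO.1 q).lattice := by
      intro x hx
      have := Submodule.mul_mem_mul hx (natCast_mem_primeIdeal O q)
      rwa [← nsmul_eq_mul', ← natCast_zsmul] at this
    refine ⟨J.mulPrime hO.1 q, ?_, hle'.trans hle, fun x hx => ?_, ?_⟩
    · rw [sigmaList_cons, hJ]
      rfl
    · rw [List.map_cons, List.prod_cons, Nat.cast_mul, mul_smul]
      exact hmem' _ (hmem x hx)
    · intro p hp r hpN hI
      obtain ⟨h1, h2⟩ := hmax p r hpN hI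
      by_cases hpq : (⟨p, hp.out⟩ : Nat.Primes) = q
      · subst hpq
        -- As the list has no repetition, the radius at `p` is still `r` and drops here for the only
        -- time.
        refine ⟨fun _ => ?_, fun h => absurd List.mem_cons_self h⟩
        refine (h2 hl.1).mul_primeIdeal ha hb hO (hN p hpN) hu hpN fun h => ?_
        rw [sq] at h
        exact hp.out.not_isUnit (hNsq p h)
      · have hdvd : ¬ (p : ℤ) ∣ ((q : ℕ) : ℤ) := by
          rw [Int.natCast_dvd_natCast]
          exact fun h => hpq (Subtype.ext ((Nat.prime_dvd_prime_iff_eq hp.out q.2).1 h))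
        refine ⟨fun h => ?_, fun h => ?_⟩
        · exact (h1 ((List.mem_cons.1 h).resolve_left hpq)).of_le_of_zsmul_mem hle' hdvd hmem'
        · exact (h2 fun h' => h (List.mem_cons_of_mem _ h')).of_le_of_zsmul_mem hle' hdvd hmem'

/-- The right ideal `O + u O`. -/
def idealOneAdd (hO : IsOrder O) (u : QAlg a b) : RightIdeal O where
  lattice := Subalgebra.toSubmodule O ⊔ (Subalgebra.toSubmodule O).map (LinearMap.mulLeft ℤ u)
  full := by
    refine ⟨hO.1.sup (hO.1.map _), ?_⟩
    rw [eq_top_iff, ← hO.2]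
    exact Submodule.span_mono (SetLike.coe_subset_coe.2 le_sup_left)
  mul_mem := by
    intro x hx y hy
    obtain ⟨v, hv, _, ⟨w, hw, rfl⟩, rfl⟩ := Submodule.mem_sup.1 hx
    rw [add_mul]
    refine Submodule.add_mem_sup (O.mul_mem hv hy) ⟨w * y, O.mul_mem hw hy, ?_⟩
    simp [mul_assoc]

/-- The class of `O + u O` is fixed by `σ_N` if `u² = -N`. -/
theorem exists_sigmaProd_eq (ha : a < 0) (hb : b < 0) (hO : IsMaximalOrder O) {N : ℕ}
    (hN : IsDiscriminant a b N) : ∃ x : Cl O, sigmaProd hO.1 N x = x := by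
  have hsplit : ∀ (p : ℕ) [Fact p.Prime], p ∣ N ↔ ¬ Split (a : ℚ_[p]) b := by
    intro p hp
    rw [← isRamified_iff ⟨p, hp.out⟩]
    exact hN.2 ⟨p, hp.out⟩
  have hsplit' : ∀ (p : ℕ) [Fact p.Prime], p ∣ N → ¬ Split (a : ℚ_[p]) b :=
    fun p _ => (hsplit p).1
  obtain ⟨x, y, z, hxyz⟩ := HasSqrtNegDisc.of_neg ha hb N hN.1 hsplit
  let w : QAlg a b := ⟨0, x, y, z⟩
  have hwN : nrd w = N := by
    rw [nrd_eq]
    simp only [w]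
    linear_combination -hxyz
  have hww : w * w = ((-N : ℤ) : QAlg a b) := by
    ext <;> simp [w]
    · linear_combination hxyz
    all_goals ring
  have hN0 : (N : ℚ) ≠ 0 := by exact_mod_cast hN.1.ne_zero
  have hw0 : w ≠ 0 := by
    intro h
    rw [h, nrd_zero] at hwN
    exact hN0 hwN.symm
  obtain ⟨u, hu⟩ := isUnit_of_ne_zero ha hb hw0
  -- `w` need not lie in `O`; adding `wO` makes the ideal stable under left multiplication by `w`.
  set I := idealOneAdd hO.1 w with hI
  obtain ⟨J, hJ, hle, hmem, hmax⟩ := RightIdeal.exists_cls_eq_sigmaList ha hb hO hwN hN.1 hsplit' I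
    (primesList N) (List.Nodup.of_map (fun p : Nat.Primes => (p : ℕ)) (by
      rw [map_val_primesList]
      exact (Nat.squarefree_iff_nodup_primeFactorsList hN.1.ne_zero).1 hN.1))
    (fun p hp => (mem_primesList hN.1.ne_zero p).1 hp)
  rw [map_val_primesList, Nat.prod_primeFactorsList hN.1.ne_zero] at hmem
  have hule : (I.translate u).lattice ≤ I.lattice := by
    rintro _ ⟨v, hv, rfl⟩
    rw [LinearMap.mulLeft_apply, hu]
    obtain ⟨v₀, hv₀, _, ⟨v', hv', rfl⟩, rfl⟩ := Submodule.mem_sup.1 hv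
    rw [mul_add, LinearMap.mulLeft_apply, ← mul_assoc, hww, add_comm]
    exact Submodule.add_mem_sup (O.mul_mem (intCast_mem O _) hv') ⟨v₀, hv₀, rfl⟩
  have humem : ∀ v ∈ I.lattice, (N : ℤ) • v ∈ (I.translate u).lattice := by
    intro v hv
    have h1 : (u : QAlg a b) * v ∈ I.lattice := hule ⟨v, hv, rfl⟩
    -- `N v = w (-(w v))`, because `w² = -N`.
    refine ⟨-((u : QAlg a b) * v), neg_mem h1, ?_⟩
    rw [LinearMap.mulLeft_apply, mul_neg, ← mul_assoc, hu, hww, Int.cast_neg, neg_mul, neg_neg,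
      zsmul_eq_mul]
  have hmaxu : ∀ (p : ℕ) [Fact p.Prime], p ∣ N → ∃ r, IsMaxPnorm p J.lattice r ∧
      IsMaxPnorm p (I.translate u).lattice r := by
    intro p hp hpN
    obtain ⟨r, hr⟩ := I.exists_isMaxPnorm ha hb (hsplit' p hpN)
    have hpl : (⟨p, hp.out⟩ : Nat.Primes) ∈ primesList N :=
      (mem_primesList hN.1.ne_zero _).2 hpN
    refine ⟨r * (p : ℝ)⁻¹, (hmax p r hpN hr).1 hpl, ?_⟩
    have h1 := hr.translate u (by rw [hu]; exact pnorm_pos ha hb hw0)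
    have h2 : pnorm p (u : QAlg a b) = (p : ℝ)⁻¹ := by
      obtain ⟨k, rfl⟩ := hpN
      have hk : ¬ p ∣ k := fun hk => hp.out.not_isUnit (hN.1 p (mul_dvd_mul_left p hk))
      have hk1 : ‖(k : ℚ_[p])‖ = 1 := le_antisymm
        (by simpa using Padic.norm_int_le_one (p := p) (k : ℤ))
        (not_lt.1 fun h => hk (Padic.norm_natCast_lt_one_iff.1 h))
      rw [hu, pnorm, hwN]
      push_cast
      rw [norm_mul, Padic.norm_p, hk1, mul_one]
    rwa [h2] at h1
  -- Both ideals lie between `N I` and `I` and have the same radius at each `p ∣ N`.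
  have hJu : J = I.translate u := RightIdeal.ext (le_antisymm
    (RightIdeal.le_of_isMaxPnorm ha hb hO hsplit' (fun v hv => humem v (hle hv)) hmaxu)
    (RightIdeal.le_of_isMaxPnorm ha hb hO hsplit' (fun v hv => hmem v (hule hv))
      fun p _ hpN => (hmaxu p hpN).imp fun _ h => h.symm))
  refine ⟨I.cls, ?_⟩
  rw [sigmaProd_eq_sigmaList, hJ, hJu]
  exact (Quotient.sound ⟨u, rfl⟩ : I.cls = (I.translate u).cls).symm

/-! ### Signs along paths of involutions -/

section SignedGraph

variable {N : ℕ}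

lemma SignedPath.snoc {hO : IsOrder O} {ε : SignPattern N} {x y z : Cl O} {s t : ℤˣ}
    (h : SignedPath hO ε x y s) (e : SignedEdge hO ε y z t) : SignedPath hO ε x z (s * t) := by
  induction h with
  | nil x => simpa using SignedPath.cons e (SignedPath.nil _)
  | cons h' _ ih => rw [mul_assoc]; exact SignedPath.cons h' (ih e)

lemma signedPath_sigmaList (hO : IsOrder O) (ε : SignPattern N) (x : Cl O) {l : List Nat.Primes}
    (hl : ∀ p ∈ l, (p : ℕ) ∣ N) :
    SignedPath hO ε x (sigmaList hO l x) (l.map fun p : Nat.Primes => ε.sign p).prod := by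
  induction l with
  | nil => exact SignedPath.nil x
  | cons p l ih =>
    rw [List.map_cons, List.prod_cons, mul_comm]
    exact (ih fun q hq => hl q (List.mem_cons_of_mem _ hq)).snoc
      ⟨p, hl p List.mem_cons_self, rfl, Or.inl rfl⟩

lemma apply_sigmaList {hO : IsOrder O} {ε : SignPattern N} {φ : QMF O} (hφ : φ ∈ signSpace hO ε)
    (x : Cl O) {l : List Nat.Primes} (hl : ∀ p ∈ l, (p : ℕ) ∣ N) :
    φ (sigmaList hO l x) = (((l.map fun p : Nat.Primes => ε.sign p).prod : ℤˣ) : ℤ) * φ x := by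
  induction l with
  | nil => simp
  | cons p l ih =>
    rw [sigmaList_cons, hφ p (hl p List.mem_cons_self),
      ih fun q hq => hl q (List.mem_cons_of_mem _ hq), List.map_cons, List.prod_cons]
    push_cast
    ring

lemma SignPattern.prod_sign (ε : SignPattern N) (hN : Squarefree N) {l : List ℕ}
    (hl : l.prod ∣ N) : (l.map ε.sign).prod = ε.sign l.prod := by
  induction l with
  | nil => simp [ε.map_one]
  | cons p l ih =>
    rw [List.prod_cons] at hl
    rw [List.map_cons, List.prod_cons, List.prod_cons, ih ((dvd_mul_left _ _).trans hl),
      ε.map_mul _ _ hl (Nat.coprime_of_squarefree_mul (hN.squarefree_of_dvd hl))]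

end SignedGraph

end DefiniteQuaternion

end

open DefiniteQuaternion
theorem corollary3p5 (a b : ℚ) (ha : a < 0) (hb : b < 0) (N : ℕ) (hN : IsDiscriminant a b N)
    (O : Subalgebra ℤ (QAlg a b)) (hO : IsMaximalOrder O) :
    (∃ x : Cl O, sigmaProd hO.1 N x = x) ∧
    ∀ ε : SignPattern N, ε.sign N = -1 →
      ∀ φ ∈ signSpace hO.1 ε, IsEigenform N φ → ∃ x : Cl O, IsTrivialZero hO.1 ε φ x := by
  obtain ⟨x, hx⟩ := exists_sigmaProd_eq ha hb hO hN
  refine ⟨⟨x, hx⟩, fun ε hε φ hφ _ => ⟨x, hφ, ?_⟩⟩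
  rw [sigmaProd_eq_sigmaList] at hx
  have hl : ∀ p ∈ primesList N, (p : ℕ) ∣ N :=
    fun p hp => (mem_primesList hN.1.ne_zero p).1 hp
  have hprod : ((primesList N).map fun p : Nat.Primes => ε.sign p).prod = -1 := by
    have h1 : ((primesList N).map fun p : Nat.Primes => ε.sign p) = N.primeFactorsList.map ε.sign := by
      rw [← map_val_primesList, List.map_map]
      rfl
    rw [h1, ε.prod_sign hN.1 (by rw [Nat.prod_primeFactorsList hN.1.ne_zero]),
      Nat.prod_primeFactorsList hN.1.ne_zero, hε]
  refine ⟨?_, ?_⟩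
  · have h1 := apply_sigmaList hφ x hl
    rw [hx, hprod] at h1
    push_cast at h1
    linear_combination h1 / 2
  · refine fun h => h ⟨x, ⟨1, SignedPath.nil x⟩, ?_⟩
    have h1 := signedPath_sigmaList hO.1 ε x hl
    rwa [hx, hprod] at h1
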